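/- **Performance scaling in lattices.** Fix $\alpha,k,\gamma,q,\tau>0$, bounds $0<b_{\min}\le b_{\max}$, an integer $p\ge 1$ and a real $\rho\ge 1$. For $d=1$ let $\mathcal G$ be the $p$-fuzz of the path graph on $n$ nodes; for $d=2$ let $\mathcal G$ be the $p$-fuzz of an $n_1\times n_2$ rectangular lattice with $n=n_1n_2$ nodes. (The $p$-fuzz of a graph joins all pairs of distinct nodes at graph distance at most $p$; for $p=1$ it is the graph itself.) Give each edge $\{i,j\}$ of $\mathcal G$ a susceptance $b_{ij}=b_{ji}>0$, and let $\mathcal L_B$ be the Laplacian of $\mathcal G$ with weights $b_{ij}$. For $\varepsilon>0$ consider the DAPI-controlled power network $$\dot\theta=\omega,\qquad \tau\dot\omega=-k\mathcal L_B\theta-\omega+\Omega+w_P,\qquad q\dot\Omega=-\omega-\gamma\mathcal L_B\Omega+\varepsilon w_\eta,\qquad y=(\alpha\mathcal L_B)^{1/2}\theta,$$ where $w_P$ (power injection noise) and $w_\eta$ (measurement noise) take values in $\mathbb R^n$. Let $\mathcal S^{\mathrm{DAPI}}_P$ be the system with input $w_P$ only, $\mathcal S^{\mathrm{DAPI}}_\eta$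 the system with input $w_\eta$ only, and let $\|\cdot\|_2$ be the $\mathcal H_2$ norm: for the system $\dot x=Ax+Bw$, $y=Cx$, $$\|\mathcal S\|_2^2=\int_0^\infty \operatorname{tr}\big(H(t)^{\top}H(t)\big)\,dt\in[0,\infty],\qquad H(t)=Ce^{tA}B,$$ which is the limit as $t\to\infty$ of $\mathbf E\{y(t)^\top y(t)\}$ for the system started at rest and driven by unit-intensity white noise. Measurement noise: there are constants $\underline c,\bar c>0$ and $N$, depending only on $\alpha,k,\gamma,q,\tau,b_{\min},b_{\max},p,\rho$, such that for all $n\ge N$, all $\varepsilon>0$ and all susceptances with $b_{\min}\le b_{ij}\le b_{\max}$ on the edges, $$\underline c\,\varepsilon^2 n\le \tfrac1n\|\mathcal S^{\mathrm{DAPI}}_\eta\|_2^2\le\bar c\,\varepsilon^2 n\quad\text{if } d=1,$$ $$\underline c\,\varepsilon^2\log n\le \tfrac1n\|\mathcal S^{\mathrm{DAPI}}_\eta\|_2^2\le\bar c\,\varepsilon^2\log n\quad\text{if } d=2,$$ where for $d=2$ the sides satisfy $n_1\le\rho n_2$ and $n_2\le\rho n_1$ (the square lattices are the case $n_1=n_2$).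 Power injection noise: for $d=1,2$, every $n\ge1$ and all susceptances $b_{ij}>0$ on the edges, $$\tfrac1n\|\mathcal S^{\mathrm{DAPI}}_P\|_2^2\le\frac{\alpha}{2k}.$$ -/

import Mathlib

open scoped ENNReal

noncomputable section

namespace SimpleGraph

/-- The `p`-fuzz of a graph: distinct nodes are joined by an edge exactly when their graph
distance in `G` is at most `p`. -/
def fuzz {V : Type*} (G : SimpleGraph V) (p : ℕ) : SimpleGraph V where
  Adj u v := u ≠ v ∧ G.edist u v ≤ p
  symm := ⟨fun u v h => ⟨h.1.symm, by rw [SimpleGraph.edist_comm]; exact h.2⟩⟩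
  loopless := ⟨fun _ h => h.1 rfl⟩

/-- The `1`-fuzz of a graph is the graph itself. -/
theorem fuzz_one {V : Type*} (G : SimpleGraph V) : G.fuzz 1 = G := by
  ext u v
  constructor
  · rintro ⟨hne, h⟩
    have h1 : G.edist u v ≠ 0 := fun h0 => hne (SimpleGraph.edist_eq_zero_iff.1 h0)
    have h2 : G.edist u v = 1 := le_antisymm (by simpa using h) (Order.one_le_iff_ne_zero.2 h1)
    exact SimpleGraph.edist_eq_one_iff_adj.1 h2
  · intro h
    exact ⟨h.ne, by rw [SimpleGraph.edist_eq_one_iff_adj.2 h]; simp⟩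

end SimpleGraph

namespace PowerNetwork

/-- `w` is a system of (symmetric, positive) edge weights on the graph `G`, extended by zero to
the pairs of nodes that are not joined by an edge. -/
structure IsEdgeWeight {V : Type*} (G : SimpleGraph V) (w : V → V → ℝ) : Prop where
  symm : ∀ i j, w i j = w j i
  pos_of_adj : ∀ i j, G.Adj i j → 0 < w i j
  eq_zero_of_not_adj : ∀ i j, ¬ G.Adj i j → w i j = 0

/-- The weighted graph Laplacian: `-w i j` off the diagonal, and on the diagonal the sum of the
weights of the edges at the node (recall that `w` vanishes on non-edges). -/
def laplacian {V : Type*} [Fintype V] [DecidableEq V] (w : V → V → ℝ) : Matrix V V ℝ :=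
  Matrix.of fun i j => if i = j then ∑ l, w i l else -w i j

/-- A continuous-time linear time-invariant system `x' = A x + B w`, `y = C x`. -/
structure LTISystem (X W Y : Type*) where
  A : Matrix X X ℝ
  B : Matrix X W ℝ
  C : Matrix Y X ℝ

namespace LTISystem

variable {X W Y : Type*} [Fintype X] [DecidableEq X] [Fintype W] [Fintype Y]

/-- The impulse response `t ↦ C exp(t A) B`. -/
def impulseResponse (S : LTISystem X W Y) (t : ℝ) : Matrix Y W ℝ :=
  S.C * NormedSpace.exp (t • S.A) * S.B

/-- The squared `H₂` norm `∫₀^∞ tr (H(t)ᵀ H(t)) dt` of the system with impulse response `H`.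
As a function of the upper limit of integration this is the output variance `E (y(t)ᵀ y(t))` of
the system started at rest and driven by white noise of unit intensity, so the `H₂` norm is the
limit of that variance as `t → ∞`. It takes the value `∞` if the integral diverges. -/
def h2NormSq (S : LTISystem X W Y) : ℝ≥0∞ :=
  ∫⁻ t in Set.Ioi (0 : ℝ),
    ENNReal.ofReal (Matrix.trace ((S.impulseResponse t).transpose * S.impulseResponse t))

/-- The system with only the input channels selected by `f`; the other inputs are switched off. -/
def selectInputs {W' : Type*} (S : LTISystem X W Y) (f : W' → W) : LTISystem X W' Y where
  A := S.A
  B := S.B.submatrix id f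
  C := S.C

end LTISystem

section DAPI

variable {V : Type*} [Fintype V] [DecidableEq V]

open scoped MatrixOrder in
/-- The closed-loop DAPI-controlled network with state `(θ, ω, Ω)`, input `w = (w_P, w_η)`
(where the power injection noise is `P = w_P` and the measurement noise is `η = ε w_η`),
and output `y = L_G^{1/2} θ`:
`θ' = ω`, `T ω' = - K L_B θ - ω + Ω + P`, `Q Ω' = - ω - L_C Ω + η`.
Here `K`, `T`, `Q` are diagonal, with (positive) diagonals `kk`, `tt`, `qq`; `b`, `c`, `g` are the
susceptances, the communication weights and the conductances; and `CFC.sqrt` is the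
positive semidefinite square root. -/
def dapi (b c g : V → V → ℝ) (kk tt qq : V → ℝ) (ε : ℝ) :
    LTISystem (V ⊕ (V ⊕ V)) (V ⊕ V) V where
  A := Matrix.fromBlocks
    0 (Matrix.fromCols 1 0)
    (Matrix.fromRows
      (-(Matrix.diagonal fun i => (tt i)⁻¹) * (Matrix.diagonal kk * laplacian b)) 0)
    (Matrix.fromBlocks
      (-(Matrix.diagonal fun i => (tt i)⁻¹)) (Matrix.diagonal fun i => (tt i)⁻¹)
      (-(Matrix.diagonal fun i => (qq i)⁻¹)) (-(Matrix.diagonal fun i => (qq i)⁻¹) * laplacian c))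
  B := Matrix.fromRows 0
    (Matrix.fromBlocks
      (Matrix.diagonal fun i => (tt i)⁻¹) 0
      0 (ε • Matrix.diagonal fun i => (qq i)⁻¹))
  C := Matrix.fromCols (CFC.sqrt (laplacian g)) 0

/-- The DAPI system with uniform control parameters `k`, `τ`, `q`, uniform
conductance-to-susceptance ratio `g = α b`, and communication weights `c = γ b`. -/
def uniformDapi (b : V → V → ℝ) (α k γ q τ ε : ℝ) : LTISystem (V ⊕ (V ⊕ V)) (V ⊕ V) V :=
  dapi b (fun i j => γ * b i j) (fun i j => α * b i j) (fun _ => k) (fun _ => τ) (fun _ => q) ε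

/-- `‖S_P‖²`: the losses due to the power injection noise `P`. -/
def lossP (b : V → V → ℝ) (α k γ q τ ε : ℝ) : ℝ≥0∞ :=
  ((uniformDapi b α k γ q τ ε).selectInputs Sum.inl).h2NormSq

/-- `‖S_η‖²`: the losses due to the measurement noise `η`. -/
def lossEta (b : V → V → ℝ) (α k γ q τ ε : ℝ) : ℝ≥0∞ :=
  ((uniformDapi b α k γ q τ ε).selectInputs Sum.inr).h2NormSq

end DAPI

/-- `w` is a system of edge weights on `G` with all weights of edges in `[bmin, bmax]`. -/
def IsBoundedEdgeWeight {V : Type*} (G : SimpleGraph V) (bmin bmax : ℝ) (w : V → V → ℝ) : Prop :=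
  IsEdgeWeight G w ∧ ∀ i j, G.Adj i j → bmin ≤ w i j ∧ w i j ≤ bmax

/-- The two-dimensional `n₁ × n₂` lattice. -/
def lattice2 (n₁ n₂ : ℕ) : SimpleGraph (Fin n₁ × Fin n₂) :=
  (SimpleGraph.pathGraph n₁).boxProd (SimpleGraph.pathGraph n₂)

end PowerNetwork

end

/-!
The closed loop decouples along an eigenbasis of the Laplacian `L_B`. In a mode with eigenvalue
`λ > 0` the system is a stable linear system of third order, and its contribution to the squared
`H₂` norm is, up to the squared gain of the input, `α λ` times a diagonal entry of the observability
Gramian, which solves a Lyapunov equation and is found explicitly (`modeGramian`,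
`IsModeTrajectory.lintegral_sq`). A mode with `λ = 0` is invisible in the output. Hence
(`h2NormSq_uniformDapi`)

* a mode contributes at most `α / (2 k)` to the losses due to power injection noise (`lossP_le`);
* it contributes `ε² f(λ)` to the losses due to measurement noise (`lossEta_eq`), where `f(λ)` lies
  between two constant multiples of `1 / λ` as long as `λ` is bounded (`modeLoss_le`,
  `le_modeLoss`).

So the losses due to measurement noise are `ε²` times the trace of the pseudoinverse of `L_B`, up to
constants. The trace of the pseudoinverse is antitone in the Loewner order
(`IsEigenbasis.sum_inv_le`), and on the `p`-fuzz of a graph of bounded degree the energy with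
weights between `bmin` and `bmax` is comparable to the unweighted energy of the graph itself
(`energy_nearWeight_le`). This reduces the problem to the unweighted path and lattice
(`exists_lossEta_bounds`), whose eigenvectors are cosines and products of cosines
(`exists_isEigenbasis_pathGraph`, `IsEigenbasis.boxProd`) with eigenvalues of order `k² / n²` and
`(k² + l²) / n`. The sum of the inverse eigenvalues is of order `n² ∑ 1 / k²`, that is `n²`, for the
path, and of order `n ∑ 1 / (k² + l²)`, that is `n log n`, for the lattice.
-/

noncomputable section

namespace PowerNetwork

open Filter Topology MeasureTheory Matrix

/-! ### A single mode of the closed loop -/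

/-- A trajectory of one eigenmode of the closed loop without input: `s = k λ` and `g = γ λ`, where
`λ` is the Laplacian eigenvalue of the mode; `Ω` is the state of the integral controller. -/
structure IsModeTrajectory (s g q τ : ℝ) (θ ω Ω : ℝ → ℝ) : Prop where
  angle : ∀ t, HasDerivAt θ (ω t) t
  frequency : ∀ t, HasDerivAt ω ((-(s * θ t) - ω t + Ω t) / τ) t
  integral : ∀ t, HasDerivAt Ω ((-ω t - g * Ω t) / q) t

/-- The physical energy `s θ² + τ ω² + q Ω²` is only weakly decreasing; the cross term
`δ (2 τ θ ω + θ²)` makes it decrease exponentially. -/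
theorem IsModeTrajectory.tendsto_zero {s g q τ : ℝ} (hs : 0 < s) (hg : 0 < g) (hq : 0 < q)
    (hτ : 0 < τ) {θ ω Ω : ℝ → ℝ} (h : IsModeTrajectory s g q τ θ ω Ω) :
    Tendsto θ atTop (𝓝 0) ∧ Tendsto ω atTop (𝓝 0) ∧ Tendsto Ω atTop (𝓝 0) := by
  obtain ⟨δ, hδ, hδτ, hδs⟩ : ∃ δ : ℝ, 0 < δ ∧ δ * τ ≤ 1 / 2 ∧ δ ≤ s * g := by
    refine ⟨min (1 / (2 * τ)) (s * g), by positivity, ?_, min_le_right _ _⟩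
    calc min (1 / (2 * τ)) (s * g) * τ ≤ 1 / (2 * τ) * τ := by gcongr; exact min_le_left _ _
      _ = 1 / 2 := by field_simp
  obtain ⟨κ, hκ, hκ1, hκ2, hκ3⟩ : ∃ κ : ℝ, 0 < κ ∧ κ * (2 * τ) ≤ 1 ∧ κ * q ≤ g ∧
      κ * (s + 2 * δ) ≤ δ * s := by
    refine ⟨min (1 / (2 * τ)) (min (g / q) (δ * s / (s + 2 * δ))), by positivity, ?_, ?_, ?_⟩
    · rw [← le_div_iff₀ (by positivity)]; exact min_le_left _ _
    · rw [← le_div_iff₀ (by positivity)]; exact (min_le_right _ _).trans (min_le_left _ _)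
    · rw [← le_div_iff₀ (by positivity)]; exact (min_le_right _ _).trans (min_le_right _ _)
  set F : ℝ → ℝ := fun t => s * θ t ^ 2 + τ * ω t ^ 2 + q * Ω t ^ 2
    + δ * (2 * τ * (θ t * ω t) + θ t ^ 2) with hF
  have hF' : ∀ t, HasDerivAt F (-2 * ω t ^ 2 - 2 * g * Ω t ^ 2
      + δ * (-2 * s * θ t ^ 2 + 2 * (θ t * Ω t) + 2 * τ * ω t ^ 2)) t := by
    intro t
    have h1 := h.angle t
    have h2 := h.frequency t
    have h3 := h.integral t
    refine (((((h1.fun_pow 2).const_mul s).fun_add ((h2.fun_pow 2).const_mul τ)).fun_add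
      ((h3.fun_pow 2).const_mul q)).fun_add
      ((((h1.fun_mul h2).const_mul (2 * τ)).fun_add (h1.fun_pow 2)).const_mul δ)).congr_deriv ?_
    push_cast
    field_simp
    ring
  -- `δ` is so small that half of the damping absorbs what the cross term adds
  have hle : ∀ t, -2 * ω t ^ 2 - 2 * g * Ω t ^ 2
      + δ * (-2 * s * θ t ^ 2 + 2 * (θ t * Ω t) + 2 * τ * ω t ^ 2) ≤ -κ * F t := by
    intro t
    have a1 : δ * (2 * (θ t * Ω t)) ≤ δ * s * θ t ^ 2 + g * Ω t ^ 2 := by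
      have e1 : δ / s ≤ g := by rw [div_le_iff₀ hs]; linarith
      have e2 : δ / s * Ω t ^ 2 ≤ g * Ω t ^ 2 := by gcongr
      have e3 : 0 ≤ δ / s * (s * θ t - Ω t) ^ 2 := by positivity
      have e4 : δ / s * (s * θ t - Ω t) ^ 2
          = δ * s * θ t ^ 2 - δ * (2 * (θ t * Ω t)) + δ / s * Ω t ^ 2 := by
        field_simp
        ring
      linarith
    have a2 : F t ≤ (s + 2 * δ) * θ t ^ 2 + 2 * τ * ω t ^ 2 + q * Ω t ^ 2 := by
      have e1 : 0 ≤ δ * (θ t - τ * ω t) ^ 2 := by positivity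
      have e2 : δ * τ * (τ * ω t ^ 2) ≤ 1 / 2 * (τ * ω t ^ 2) := by gcongr
      have e3 : 0 ≤ τ * ω t ^ 2 := by positivity
      simp only [hF]
      nlinarith
    have a3 : κ * F t ≤ κ * ((s + 2 * δ) * θ t ^ 2 + 2 * τ * ω t ^ 2 + q * Ω t ^ 2) := by gcongr
    have a4 : κ * (s + 2 * δ) * θ t ^ 2 ≤ δ * s * θ t ^ 2 := by gcongr
    have a5 : κ * (2 * τ) * ω t ^ 2 ≤ 1 * ω t ^ 2 := by gcongr
    have a6 : κ * q * Ω t ^ 2 ≤ g * Ω t ^ 2 := by gcongr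
    have a7 : δ * τ * ω t ^ 2 ≤ 1 / 2 * ω t ^ 2 := by gcongr
    linarith
  have hlow : ∀ t, s * θ t ^ 2 + τ / 2 * ω t ^ 2 + q * Ω t ^ 2 ≤ F t := by
    intro t
    have e1 : 0 ≤ δ * (θ t + τ * ω t) ^ 2 := by positivity
    have e2 : δ * τ * (τ * ω t ^ 2) ≤ 1 / 2 * (τ * ω t ^ 2) := by gcongr
    simp only [hF]
    linarith
  have hanti : Antitone fun t => F t * Real.exp (κ * t) := by
    have hd : ∀ t, HasDerivAt (fun t => F t * Real.exp (κ * t)) _ t := fun t =>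
      (hF' t).mul (((hasDerivAt_id t).const_mul κ).exp)
    refine antitone_of_deriv_nonpos (fun t => (hd t).differentiableAt) fun t => ?_
    rw [(hd t).deriv]
    have := mul_le_mul_of_nonneg_right (hle t) (Real.exp_pos (κ * t)).le
    simp only [id, mul_one]
    linarith
  have hbound : ∀ t, 0 ≤ t → F t ≤ F 0 * Real.exp (-(κ * t)) := by
    intro t ht
    have h0 := hanti ht
    simp only [mul_zero, Real.exp_zero, mul_one] at h0
    rw [Real.exp_neg, ← div_eq_mul_inv, le_div_iff₀ (Real.exp_pos _)]
    exact h0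
  have hlim : Tendsto (fun t => F 0 * Real.exp (-(κ * t))) atTop (𝓝 0) := by
    have : Tendsto (fun t => -(κ * t)) atTop atBot :=
      tendsto_neg_atTop_atBot.comp (tendsto_id.const_mul_atTop hκ)
    simpa using (Real.tendsto_exp_atBot.comp this).const_mul (F 0)
  -- each coordinate is controlled by `F`, which is bounded by the exponential
  have key : ∀ (x : ℝ → ℝ) (m : ℝ), 0 < m → (∀ t, m * x t ^ 2 ≤ F t) → Tendsto x atTop (𝓝 0) := by
    intro x m hm hx
    have h1 : Tendsto (fun t => m * x t ^ 2) atTop (𝓝 0) :=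
      tendsto_of_tendsto_of_tendsto_of_le_of_le' tendsto_const_nhds hlim
        (Eventually.of_forall fun t => by positivity)
        ((eventually_ge_atTop 0).mono fun t ht => (hx t).trans (hbound t ht))
    have h2 : Tendsto (fun t => x t ^ 2) atTop (𝓝 0) := by
      have := h1.const_mul m⁻¹
      simpa [← mul_assoc, inv_mul_cancel₀ hm.ne'] using this
    have h3 := (Real.continuous_sqrt.tendsto 0).comp h2
    rw [Real.sqrt_zero] at h3
    rw [tendsto_zero_iff_abs_tendsto_zero]
    exact h3.congr fun t => by simp [Real.sqrt_sq_eq_abs]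
  refine ⟨key θ s hs fun t => ?_, key ω (τ / 2) (by positivity) fun t => ?_, key Ω q hq fun t => ?_⟩
  all_goals
    have := hlow t
    have e1 : 0 ≤ s * θ t ^ 2 := by positivity
    have e2 : 0 ≤ τ / 2 * ω t ^ 2 := by positivity
    have e3 : 0 ≤ q * Ω t ^ 2 := by positivity
    linarith

/-- The Hurwitz determinant `a₁ a₂ - a₀ a₃` of the characteristic polynomial `∑ aᵢ zⁱ` of a mode,
normalized to `a₃ = τ q`: the denominator in the solution of the Lyapunov equation. -/
def modeDet (s g q τ : ℝ) : ℝ := q + g * (τ + q) + q ^ 2 * s + τ * g ^ 2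

theorem modeDet_pos {s g q τ : ℝ} (hs : 0 ≤ s) (hg : 0 ≤ g) (hq : 0 < q) (hτ : 0 < τ) :
    0 < modeDet s g q τ := by unfold modeDet; positivity

/-- The off-diagonal `ω Ω` entry of the observability Gramian of a mode with output `θ`, which
determines the other entries. -/
def modeCross (s g q τ : ℝ) : ℝ := τ / (2 * s) * q * (q + g * τ) / modeDet s g q τ

/-- The observability Gramian of a mode with output `θ`, as a quadratic form: it solves the
Lyapunov equation, that is, its derivative along trajectories is `-θ²`. -/
def modeGramian (s g q τ x y z : ℝ) : ℝ :=
  let d := τ / (2 * s)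
  let f := modeCross s g q τ
  let e := q / g * (d / τ - f * s / τ)
  let b := τ * (d - f / q)
  (b * s / τ + d / τ + e / q) * x ^ 2 + b * y ^ 2 + q * f / (g * τ) * z ^ 2
    + 2 * d * (x * y) + 2 * e * (x * z) + 2 * f * (y * z)

theorem IsModeTrajectory.hasDerivAt_modeGramian {s g q τ : ℝ} (hs : 0 < s) (hg : 0 < g)
    (hq : 0 < q) (hτ : 0 < τ) {θ ω Ω : ℝ → ℝ} (h : IsModeTrajectory s g q τ θ ω Ω) (t : ℝ) :
    HasDerivAt (fun t => modeGramian s g q τ (θ t) (ω t) (Ω t)) (-θ t ^ 2) t := by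
  have h1 := h.angle t
  have h2 := h.frequency t
  have h3 := h.integral t
  unfold modeGramian
  have hf : modeCross s g q τ * (q + g * (τ + q) + q ^ 2 * s + τ * g ^ 2)
      = τ / (2 * s) * q * (q + g * τ) := by
    have := (modeDet_pos hs.le hg.le hq hτ).ne'
    rw [modeCross, ← modeDet]
    field_simp
  generalize modeCross s g q τ = f at hf
  refine (((((((h1.fun_pow 2).const_mul _).fun_add ((h2.fun_pow 2).const_mul _)).fun_add
    ((h3.fun_pow 2).const_mul _)).fun_add ((h1.fun_mul h2).const_mul _)).fun_add
    ((h1.fun_mul h3).const_mul _)).fun_add ((h2.fun_mul h3).const_mul _)).congr_deriv ?_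
  have hf' : q * (q + g * τ) * τ = 2 * s * f * (q + g * (τ + q) + q ^ 2 * s + τ * g ^ 2) := by
    field_simp at hf
    linarith
  push_cast
  field_simp
  linear_combination (ω t * Ω t) * hf'

theorem IsModeTrajectory.lintegral_sq {s g q τ : ℝ} (hs : 0 < s) (hg : 0 < g)
    (hq : 0 < q) (hτ : 0 < τ) {θ ω Ω : ℝ → ℝ} (h : IsModeTrajectory s g q τ θ ω Ω) :
    ∫⁻ t in Set.Ioi (0 : ℝ), ENNReal.ofReal (θ t ^ 2)
      = ENNReal.ofReal (modeGramian s g q τ (θ 0) (ω 0) (Ω 0)) := by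
  obtain ⟨l1, l2, l3⟩ := h.tendsto_zero hs hg hq hτ
  have hlim : Tendsto (fun t => -modeGramian s g q τ (θ t) (ω t) (Ω t)) atTop (𝓝 0) := by
    have hc : Continuous fun v : ℝ × ℝ × ℝ => -modeGramian s g q τ v.1 v.2.1 v.2.2 := by
      unfold modeGramian; fun_prop
    have := (hc.tendsto (0, 0, 0)).comp (l1.prodMk_nhds (l2.prodMk_nhds l3))
    simpa [modeGramian, Function.comp_def] using this
  have hd : ∀ t ∈ Set.Ici (0 : ℝ),
      HasDerivAt (fun t => -modeGramian s g q τ (θ t) (ω t) (Ω t)) (θ t ^ 2) t := fun t _ =>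
    (h.hasDerivAt_modeGramian hs hg hq hτ t).fun_neg.congr_deriv (neg_neg _)
  have hint := integrableOn_Ioi_deriv_of_nonneg' hd (fun t _ => sq_nonneg _) hlim
  rw [← ofReal_integral_eq_lintegral_ofReal hint (Eventually.of_forall fun t => sq_nonneg _),
    integral_Ioi_of_hasDerivAt_of_nonneg' hd (fun t _ => sq_nonneg _) hlim]
  simp

theorem modeGramian_integral {s g q τ z : ℝ} (hs : 0 < s) (hg : 0 < g) (hq : 0 < q) (hτ : 0 < τ) :
    modeGramian s g q τ 0 0 z = q ^ 2 * (q + τ * g) / (2 * s * g * modeDet s g q τ) * z ^ 2 := by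
  have := (modeDet_pos hs.le hg.le hq hτ).ne'
  simp only [modeGramian, modeCross]
  field_simp
  ring

theorem modeGramian_frequency {s g q τ y : ℝ} (hs : 0 < s) (hg : 0 < g) (hq : 0 < q) (hτ : 0 < τ) :
    modeGramian s g q τ 0 y 0
      = τ ^ 2 * (g * (τ * g + q) + q ^ 2 * s) / (2 * s * modeDet s g q τ) * y ^ 2 := by
  have h0 := (modeDet_pos hs.le hg.le hq hτ).ne'
  have h1 : modeDet s g q τ = q + g * (τ + q) + q ^ 2 * s + τ * g ^ 2 := rfl
  simp only [modeGramian, modeCross]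
  field_simp
  rw [h1]
  ring

/-! ### Laplacians and their eigenbases -/

section Laplacian

variable {V : Type*} [Fintype V]

/-- The Dirichlet energy of `x` for the weights `w`, each pair of nodes being counted twice. -/
def energy (w : V → V → ℝ) (x : V → ℝ) : ℝ := ∑ i, ∑ j, w i j * (x i - x j) ^ 2

theorem energy_nonneg {w : V → V → ℝ} (h0 : ∀ i j, 0 ≤ w i j) (x : V → ℝ) : 0 ≤ energy w x :=
  Finset.sum_nonneg fun i _ => Finset.sum_nonneg fun j _ => mul_nonneg (h0 i j) (sq_nonneg _)

theorem energy_mono {w w' : V → V → ℝ} (h : ∀ i j, w i j ≤ w' i j) (x : V → ℝ) :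
    energy w x ≤ energy w' x :=
  Finset.sum_le_sum fun i _ => Finset.sum_le_sum fun j _ =>
    mul_le_mul_of_nonneg_right (h i j) (sq_nonneg _)

theorem energy_const_mul (a : ℝ) (w : V → V → ℝ) (x : V → ℝ) :
    energy (fun i j => a * w i j) x = a * energy w x := by
  simp only [energy, Finset.mul_sum, mul_assoc]

variable [DecidableEq V]

theorem laplacian_mulVec_apply {w : V → V → ℝ} (hw : ∀ i, w i i = 0) (x : V → ℝ) (i : V) :
    (laplacian w *ᵥ x) i = ∑ j, w i j * (x i - x j) := by
  have h : ∀ j, laplacian w i j * x j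
      = (if i = j then (∑ l, w i l) * x j else 0) - w i j * x j := by
    intro j
    by_cases hij : i = j
    · subst hij; simp [laplacian, hw]
    · simp [laplacian, hij]
  simp only [mulVec, dotProduct, h, Finset.sum_sub_distrib, Finset.sum_ite_eq, Finset.mem_univ,
    if_true, mul_sub, Finset.sum_mul]

theorem dotProduct_laplacian {w : V → V → ℝ} (hs : ∀ i j, w i j = w j i) (hw : ∀ i, w i i = 0)
    (x : V → ℝ) : x ⬝ᵥ laplacian w *ᵥ x = energy w x / 2 := by
  have h1 : x ⬝ᵥ laplacian w *ᵥ x = ∑ i, ∑ j, x i * (w i j * (x i - x j)) := by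
    simp only [dotProduct, laplacian_mulVec_apply hw, Finset.mul_sum]
  have h2 : ∑ i, ∑ j, x i * (w i j * (x i - x j)) = ∑ i, ∑ j, x j * (w i j * (x j - x i)) := by
    rw [Finset.sum_comm]
    exact Finset.sum_congr rfl fun i _ => Finset.sum_congr rfl fun j _ => by rw [hs]
  have h3 : energy w x
      = ∑ i, ∑ j, x i * (w i j * (x i - x j)) + ∑ i, ∑ j, x j * (w i j * (x j - x i)) := by
    simp only [energy, ← Finset.sum_add_distrib]
    exact Finset.sum_congr rfl fun i _ => Finset.sum_congr rfl fun j _ => by ring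
  rw [h3, ← h2, h1]
  ring

theorem laplacian_const_mul (a : ℝ) (w : V → V → ℝ) :
    laplacian (fun i j => a * w i j) = a • laplacian w := by
  ext i j
  simp only [laplacian, of_apply, Matrix.smul_apply, smul_eq_mul, ← Finset.mul_sum]
  split_ifs <;> ring

theorem laplacian_transpose {w : V → V → ℝ} (hs : ∀ i j, w i j = w j i) :
    (laplacian w)ᵀ = laplacian w := by
  ext i j
  by_cases hij : i = j
  · subst hij; rfl
  · simp [laplacian, hij, Ne.symm hij, hs]

theorem posSemidef_laplacian {w : V → V → ℝ} (hs : ∀ i j, w i j = w j i) (hw : ∀ i, w i i = 0)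
    (h0 : ∀ i j, 0 ≤ w i j) : (laplacian w).PosSemidef := by
  refine PosSemidef.of_dotProduct_mulVec_nonneg ?_ fun x => ?_
  · rw [IsHermitian, conjTranspose_eq_transpose_of_trivial, laplacian_transpose hs]
  · rw [star_trivial, dotProduct_laplacian hs hw]
    have := energy_nonneg h0 x
    positivity

/-- The columns of `U` are an orthonormal basis of eigenvectors of `M`, with eigenvalues `μ`. -/
structure IsEigenbasis (M U : Matrix V V ℝ) (μ : V → ℝ) : Prop where
  orthonormal : Uᵀ * U = 1
  mul_eq : M * U = U * diagonal μ

namespace IsEigenbasis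

variable {M U : Matrix V V ℝ} {μ : V → ℝ}

theorem mul_transpose (h : IsEigenbasis M U μ) : U * Uᵀ = 1 := mul_eq_one_comm.1 h.orthonormal

theorem eq_mul (h : IsEigenbasis M U μ) : M = U * diagonal μ * Uᵀ := by
  rw [← h.mul_eq, Matrix.mul_assoc, h.mul_transpose, Matrix.mul_one]

theorem transpose_mul (h : IsEigenbasis M U μ) : Uᵀ * M = diagonal μ * Uᵀ := by
  rw [h.eq_mul, ← Matrix.mul_assoc, ← Matrix.mul_assoc, h.orthonormal, Matrix.one_mul]

theorem sum_sq (h : IsEigenbasis M U μ) (i : V) : ∑ v, U v i ^ 2 = 1 := by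
  have := congrFun (congrFun h.orthonormal i) i
  simpa [Matrix.mul_apply, sq] using this

theorem dotProduct_mulVec (h : IsEigenbasis M U μ) (x : V → ℝ) :
    x ⬝ᵥ M *ᵥ x = ∑ i, μ i * (Uᵀ *ᵥ x) i ^ 2 := by
  have : x ⬝ᵥ M *ᵥ x = (Uᵀ *ᵥ x) ⬝ᵥ (diagonal μ *ᵥ (Uᵀ *ᵥ x)) := by
    conv_lhs => rw [h.eq_mul, ← mulVec_mulVec, ← mulVec_mulVec, Matrix.dotProduct_mulVec,
      ← mulVec_transpose]
  rw [this]
  simp only [dotProduct, mulVec_diagonal]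
  exact Finset.sum_congr rfl fun i _ => by ring

theorem transpose_mulVec_col (h : IsEigenbasis M U μ) (i : V) :
    Uᵀ *ᵥ (fun v => U v i) = Pi.single i 1 := by
  ext l
  have := congrFun (congrFun h.orthonormal l) i
  rw [Matrix.one_apply] at this
  rw [Pi.single_apply]
  exact this

theorem eigenvalue_eq (h : IsEigenbasis M U μ) (i : V) :
    μ i = (fun v => U v i) ⬝ᵥ M *ᵥ (fun v => U v i) := by
  rw [h.dotProduct_mulVec, h.transpose_mulVec_col, Finset.sum_eq_single i]
  · simp
  · intro l _ hl
    simp [hl]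
  · simp

end IsEigenbasis

theorem exists_isEigenbasis {M : Matrix V V ℝ} (hM : M.IsHermitian) :
    ∃ (U : Matrix V V ℝ) (μ : V → ℝ), IsEigenbasis M U μ := by
  have hU : (hM.eigenvectorUnitary : Matrix V V ℝ)ᵀ *
      (hM.eigenvectorUnitary : Matrix V V ℝ) = 1 := by
    have := (Matrix.mem_unitaryGroup_iff'.1 hM.eigenvectorUnitary.2)
    rwa [star_eq_conjTranspose, conjTranspose_eq_transpose_of_trivial] at this
  refine ⟨hM.eigenvectorUnitary, hM.eigenvalues, hU, ?_⟩
  have h := hM.spectral_theorem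
  rw [Unitary.conjStarAlgAut_apply] at h
  have h2 := congrArg (fun N => N * (hM.eigenvectorUnitary : Matrix V V ℝ)) h
  beta_reduce at h2
  rw [h2, star_eq_conjTranspose, conjTranspose_eq_transpose_of_trivial, Matrix.mul_assoc, hU,
    Matrix.mul_one]
  rfl

end Laplacian

/-! ### Modal decomposition of the closed loop -/

section Modal

variable {V W : Type*} [Fintype V] [DecidableEq V]

theorem hasDerivAt_exp_smul_mul {X : Type*} [Fintype X] [DecidableEq X] (A : Matrix X X ℝ)
    (B : Matrix X W ℝ) (t : ℝ) (x : X) (c : W) :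
    HasDerivAt (fun t : ℝ => (NormedSpace.exp (t • A) * B) x c)
      ((A * (NormedSpace.exp (t • A) * B)) x c) t := by
  let _ : NormedRing (Matrix X X ℝ) := Matrix.linftyOpNormedRing
  let _ : NormedAlgebra ℝ (Matrix X X ℝ) := Matrix.linftyOpNormedAlgebra
  have h := hasDerivAt_exp_smul_const' (𝕂 := ℝ) A t
  let φ : Matrix X X ℝ →ₗ[ℝ] ℝ :=
    { toFun := fun N => (N * B) x c
      map_add' := fun N N' => by rw [Matrix.add_mul]; rfl
      map_smul' := fun a N => by rw [Matrix.smul_mul]; rfl }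
  have h2 := (LinearMap.toContinuousLinearMap φ).hasFDerivAt.comp_hasDerivAt t h
  rw [← Matrix.mul_assoc]
  exact h2

/-- The `i`-th modal coordinates of the closed-loop impulse response in the input channel `c` are a
trajectory of the mode with eigenvalue `μ i`. -/
theorem isModeTrajectory_exp {b : V → V → ℝ} {U : Matrix V V ℝ} {μ : V → ℝ}
    (hU : IsEigenbasis (laplacian b) U μ) (α k γ q τ ε : ℝ) (B : Matrix (V ⊕ (V ⊕ V)) W ℝ)
    (i : V) (c : W) :
    let Z := fun t : ℝ => NormedSpace.exp (t • (uniformDapi b α k γ q τ ε).A) * B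
    IsModeTrajectory (k * μ i) (γ * μ i) q τ
      (fun t => ∑ v, U v i * Z t (Sum.inl v) c)
      (fun t => ∑ v, U v i * Z t (Sum.inr (Sum.inl v)) c)
      (fun t => ∑ v, U v i * Z t (Sum.inr (Sum.inr v)) c) := by
  intro Z
  have hd : ∀ t x, HasDerivAt (fun t => Z t x c) (((uniformDapi b α k γ q τ ε).A * Z t) x c) t :=
    fun t x => hasDerivAt_exp_smul_mul _ _ _ _ _
  have hsum : ∀ (e : V → V ⊕ (V ⊕ V)) (t : ℝ),
      HasDerivAt (fun t => ∑ v, U v i * Z t (e v) c)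
        (∑ v, U v i * ((uniformDapi b α k γ q τ ε).A * Z t) (e v) c) t := fun e t =>
    HasDerivAt.fun_sum fun v _ => (hd t (e v)).const_mul (U v i)
  have hL : ∀ y : V → ℝ, ∑ v, U v i * ∑ j, laplacian b v j * y j = μ i * ∑ v, U v i * y v := by
    intro y
    have h := congrFun (congrArg (fun N => N *ᵥ y) hU.transpose_mul) i
    simp only [← mulVec_mulVec, mulVec_diagonal] at h
    exact h
  have hlin : ∀ (a κ : ℝ) (x y z : V → ℝ), ∑ v, U v i * (a * (-(κ * x v) - y v + z v))
      = a * (-(κ * ∑ v, U v i * x v) - ∑ v, U v i * y v + ∑ v, U v i * z v) := by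
    intro a κ x y z
    simp only [Finset.mul_sum, ← Finset.sum_neg_distrib, ← Finset.sum_sub_distrib,
      ← Finset.sum_add_distrib]
    exact Finset.sum_congr rfl fun v _ => by ring
  refine ⟨fun t => (hsum _ t).congr_deriv ?_, fun t => (hsum _ t).congr_deriv ?_,
    fun t => (hsum _ t).congr_deriv ?_⟩
  · refine Finset.sum_congr rfl fun v _ => ?_
    simp [uniformDapi, dapi, Matrix.mul_apply, Fintype.sum_sum_type, Matrix.one_apply]
  · have : ∀ v, ((uniformDapi b α k γ q τ ε).A * Z t) (Sum.inr (Sum.inl v)) c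
        = τ⁻¹ * (-(k * ∑ j, laplacian b v j * Z t (Sum.inl j) c) - Z t (Sum.inr (Sum.inl v)) c
          + Z t (Sum.inr (Sum.inr v)) c) := by
      intro v
      simp [uniformDapi, dapi, Matrix.mul_apply, Fintype.sum_sum_type, Matrix.diagonal_apply,
        Finset.mul_sum]
      simp only [mul_add, mul_sub, mul_neg, Finset.mul_sum, mul_assoc]
      ring
    simp only [this]
    have e := hL fun j => Z t (Sum.inl j) c
    calc _ = τ⁻¹ * (-(k * ∑ v, U v i * ∑ j, laplacian b v j * Z t (Sum.inl j) c)
          - ∑ v, U v i * Z t (Sum.inr (Sum.inl v)) c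
          + ∑ v, U v i * Z t (Sum.inr (Sum.inr v)) c) := by
          exact hlin _ _ (fun v => ∑ j, laplacian b v j * Z t (Sum.inl j) c) _ _
      _ = _ := by rw [e]; ring
  · have : ∀ v, ((uniformDapi b α k γ q τ ε).A * Z t) (Sum.inr (Sum.inr v)) c
        = q⁻¹ * (-Z t (Sum.inr (Sum.inl v)) c
          - γ * ∑ j, laplacian b v j * Z t (Sum.inr (Sum.inr j)) c) := by
      intro v
      simp [uniformDapi, dapi, Matrix.mul_apply, Fintype.sum_sum_type, Matrix.diagonal_apply,
        Finset.mul_sum, laplacian_const_mul]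
      simp only [mul_sub, mul_neg, Finset.mul_sum, mul_assoc, mul_left_comm q⁻¹ γ]
      ring
    simp only [this]
    have e := hL fun j => Z t (Sum.inr (Sum.inr j)) c
    calc _ = q⁻¹ * (-(∑ v, U v i * Z t (Sum.inr (Sum.inl v)) c)
          - γ * ∑ v, U v i * ∑ j, laplacian b v j * Z t (Sum.inr (Sum.inr j)) c) := by
          have := hlin q⁻¹ γ (fun v => ∑ j, laplacian b v j * Z t (Sum.inr (Sum.inr j)) c)
            (fun v => Z t (Sum.inr (Sum.inl v)) c) 0
          simp only [Pi.zero_apply, mul_zero, Finset.sum_const_zero, add_zero] at this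
          simp only [neg_sub_left, add_comm] at this ⊢
          exact this
      _ = _ := by rw [e]; ring

open scoped MatrixOrder in
/-- The squared `H₂` norm of the closed loop is the sum over modes and input channels of the
observability Gramians of the modes, evaluated at the modal coordinates of the input matrix. -/
theorem h2NormSq_uniformDapi [Fintype W] {b : V → V → ℝ} (hs : ∀ i j, b i j = b j i)
    (hb : ∀ i, b i i = 0) (h0 : ∀ i j, 0 ≤ b i j) {U : Matrix V V ℝ} {μ : V → ℝ}
    (hU : IsEigenbasis (laplacian b) U μ) (hμ : ∀ i, 0 ≤ μ i) {α k γ q τ : ℝ} (hα : 0 < α)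
    (hk : 0 < k) (hγ : 0 < γ) (hq : 0 < q) (hτ : 0 < τ) (ε : ℝ) (f : W → V ⊕ V) :
    ((uniformDapi b α k γ q τ ε).selectInputs f).h2NormSq
      = ∑ i, ∑ c, ENNReal.ofReal (α * μ i * modeGramian (k * μ i) (γ * μ i) q τ 0
          (∑ v, U v i * (uniformDapi b α k γ q τ ε).B (Sum.inr (Sum.inl v)) (f c))
          (∑ v, U v i * (uniformDapi b α k γ q τ ε).B (Sum.inr (Sum.inr v)) (f c))) := by
  set S := (uniformDapi b α k γ q τ ε).selectInputs f with hS
  set Z : ℝ → Matrix (V ⊕ (V ⊕ V)) W ℝ := fun t => NormedSpace.exp (t • S.A) * S.B with hZ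
  have hmode := isModeTrajectory_exp hU α k γ q τ ε S.B
  have htr : ∀ t, Matrix.trace ((S.impulseResponse t).transpose * S.impulseResponse t)
      = ∑ i, ∑ c, α * μ i * (∑ v, U v i * Z t (Sum.inl v) c) ^ 2 := by
    intro t
    set Y : Matrix V W ℝ := fun v c => Z t (Sum.inl v) c with hY
    set R := CFC.sqrt (laplacian fun i j => α * b i j) with hR
    have hpsd : (laplacian fun i j => α * b i j).PosSemidef :=
      posSemidef_laplacian (fun i j => by rw [hs]) (fun i => by rw [hb, mul_zero])
        fun i j => mul_nonneg hα.le (h0 i j)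
    -- the square root enters the trace only through its square
    have hRR : Rᵀ * R = α • laplacian b := by
      have h1 : R.PosSemidef := nonneg_iff_posSemidef.1 (CFC.sqrt_nonneg _)
      have h2 : Rᵀ = R := by
        rw [← conjTranspose_eq_transpose_of_trivial]; exact h1.isHermitian
      rw [h2, hR, CFC.sqrt_mul_sqrt_self _ (nonneg_iff_posSemidef.2 hpsd), laplacian_const_mul]
    have hH : S.impulseResponse t = R * Y := by
      have : S.C = Matrix.fromCols R 0 := rfl
      rw [LTISystem.impulseResponse, Matrix.mul_assoc, this]
      ext v c
      change (fromCols R (0 : Matrix V (V ⊕ V) ℝ) * Z t) v c = (R * Y) v c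
      rw [Matrix.mul_apply, Matrix.mul_apply, Fintype.sum_sum_type]
      simp [hY]
    have h3 : (R * Y)ᵀ * (R * Y) = α • ((Uᵀ * Y)ᵀ * (diagonal μ * (Uᵀ * Y))) := by
      rw [Matrix.transpose_mul, Matrix.mul_assoc, ← Matrix.mul_assoc Rᵀ, hRR, hU.eq_mul,
        Matrix.transpose_mul, transpose_transpose]
      simp only [Matrix.smul_mul, Matrix.mul_smul, Matrix.mul_assoc]
    rw [hH, h3, trace_smul, Matrix.trace, Finset.smul_sum, Finset.sum_comm]
    refine Finset.sum_congr rfl fun c _ => ?_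
    rw [Matrix.diag_apply, Matrix.mul_apply, Finset.smul_sum]
    refine Finset.sum_congr rfl fun i _ => ?_
    rw [diagonal_mul, transpose_apply, Matrix.mul_apply, smul_eq_mul]
    simp only [transpose_apply, hY]
    ring
  have hcont : ∀ i c, Measurable fun t => ENNReal.ofReal
      (α * μ i * (∑ v, U v i * Z t (Sum.inl v) c) ^ 2) := by
    intro i c
    have h1 : Continuous fun t => ∑ v, U v i * Z t (Sum.inl v) c :=
      continuous_iff_continuousAt.2 fun t => ((hmode i c).angle t).continuousAt
    exact (ENNReal.continuous_ofReal.comp (continuous_const.mul (h1.pow 2))).measurable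
  have hZ0 : ∀ x c, Z 0 x c = S.B x c := by
    intro x c
    simp [hZ]
  calc S.h2NormSq
      = ∫⁻ t in Set.Ioi (0 : ℝ), ∑ i, ∑ c, ENNReal.ofReal
          (α * μ i * (∑ v, U v i * Z t (Sum.inl v) c) ^ 2) := by
        unfold LTISystem.h2NormSq
        refine lintegral_congr fun t => ?_
        have hp : ∀ i c, 0 ≤ α * μ i * (∑ v, U v i * Z t (Sum.inl v) c) ^ 2 := fun i c =>
          mul_nonneg (mul_nonneg hα.le (hμ i)) (sq_nonneg _)
        rw [htr t, ENNReal.ofReal_sum_of_nonneg fun i _ => Finset.sum_nonneg fun c _ => hp i c]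
        exact Finset.sum_congr rfl fun i _ => ENNReal.ofReal_sum_of_nonneg fun c _ => hp i c
    _ = ∑ i, ∑ c, ∫⁻ t in Set.Ioi (0 : ℝ), ENNReal.ofReal
          (α * μ i * (∑ v, U v i * Z t (Sum.inl v) c) ^ 2) := by
        rw [lintegral_finsetSum _ fun i _ => Finset.measurable_fun_sum _ fun c _ => hcont i c]
        exact Finset.sum_congr rfl fun i _ => lintegral_finsetSum _ fun c _ => hcont i c
    _ = _ := by
        refine Finset.sum_congr rfl fun i _ => Finset.sum_congr rfl fun c _ => ?_
        rcases (hμ i).eq_or_lt with hi | hi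
        · simp [← hi]
        · have hm : 0 ≤ α * μ i := by positivity
          simp only [ENNReal.ofReal_mul hm]
          rw [lintegral_const_mul']
          · have := (hmode i c).lintegral_sq (by positivity) (by positivity) hq hτ
            refine congrArg _ (this.trans ?_)
            have e : ∀ x, (NormedSpace.exp ((0 : ℝ) • (uniformDapi b α k γ q τ ε).A) * S.B) x c
              = S.B x c := fun x => hZ0 x c
            simp only [e]
            have e0 : ∀ v, S.B (Sum.inl v) c = 0 := fun v => rfl
            simp only [e0, mul_zero, Finset.sum_const_zero]
            rfl
          · exact ENNReal.ofReal_ne_top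

/-- The contribution of the mode with eigenvalue `x` to the losses due to measurement noise of
intensity `ε = 1`. For `x = 0` the division by zero gives the correct value `0`: this mode does not
appear in the output. -/
def modeLoss (α k γ q τ x : ℝ) : ℝ :=
  α * (q + τ * (γ * x)) / (2 * k * γ * x * modeDet (k * x) (γ * x) q τ)

theorem lossEta_eq {b : V → V → ℝ} (hs : ∀ i j, b i j = b j i)
    (hb : ∀ i, b i i = 0) (h0 : ∀ i j, 0 ≤ b i j) {U : Matrix V V ℝ} {μ : V → ℝ}
    (hU : IsEigenbasis (laplacian b) U μ) (hμ : ∀ i, 0 ≤ μ i) {α k γ q τ : ℝ} (hα : 0 < α)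
    (hk : 0 < k) (hγ : 0 < γ) (hq : 0 < q) (hτ : 0 < τ) (ε : ℝ) :
    lossEta b α k γ q τ ε = ENNReal.ofReal (ε ^ 2 * ∑ i, modeLoss α k γ q τ (μ i)) := by
  rw [lossEta, h2NormSq_uniformDapi hs hb h0 hU hμ hα hk hγ hq hτ]
  have hnn : ∀ i, 0 ≤ modeLoss α k γ q τ (μ i) := fun i => by
    have := hμ i
    have h1 := (modeDet_pos (s := k * μ i) (g := γ * μ i) (by positivity) (by positivity) hq hτ).le
    unfold modeLoss
    positivity
  rw [Finset.mul_sum, ENNReal.ofReal_sum_of_nonneg fun i _ => mul_nonneg (sq_nonneg _) (hnn i)]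
  refine Finset.sum_congr rfl fun i _ => ?_
  have hB1 : ∀ v c, (uniformDapi b α k γ q τ ε).B (Sum.inr (Sum.inl v)) (Sum.inr c) = 0 :=
    fun v c => rfl
  have hB2 : ∀ v c, (uniformDapi b α k γ q τ ε).B (Sum.inr (Sum.inr v)) (Sum.inr c)
      = if v = c then ε * q⁻¹ else 0 := fun v c => by
    simp [uniformDapi, dapi, diagonal_apply]
  simp only [hB1, hB2, mul_zero, Finset.sum_const_zero, mul_ite, Finset.sum_ite_eq',
    Finset.mem_univ, if_true]
  rcases (hμ i).eq_or_lt with hi | hi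
  · simp [← hi, modeLoss]
  · have h1 : ∀ c, α * μ i * modeGramian (k * μ i) (γ * μ i) q τ 0 0 (U c i * (ε * q⁻¹))
        = ε ^ 2 * modeLoss α k γ q τ (μ i) * U c i ^ 2 := by
      intro c
      have hdet := (modeDet_pos (s := k * μ i) (g := γ * μ i) (by positivity) (by positivity)
        hq hτ).ne'
      rw [modeGramian_integral (by positivity) (by positivity) hq hτ, modeLoss]
      field_simp
    simp only [h1]
    rw [← ENNReal.ofReal_sum_of_nonneg fun c _ => mul_nonneg (mul_nonneg (sq_nonneg _) (hnn i))
      (sq_nonneg _), ← Finset.mul_sum, hU.sum_sq, mul_one]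

/-- Every mode contributes at most `α / (2 k)` to the losses due to power injection noise. -/
theorem lossP_le {b : V → V → ℝ} (hs : ∀ i j, b i j = b j i)
    (hb : ∀ i, b i i = 0) (h0 : ∀ i j, 0 ≤ b i j) {U : Matrix V V ℝ} {μ : V → ℝ}
    (hU : IsEigenbasis (laplacian b) U μ) (hμ : ∀ i, 0 ≤ μ i) {α k γ q τ : ℝ} (hα : 0 < α)
    (hk : 0 < k) (hγ : 0 < γ) (hq : 0 < q) (hτ : 0 < τ) (ε : ℝ) :
    lossP b α k γ q τ ε ≤ ENNReal.ofReal (α / (2 * k)) * Fintype.card V := by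
  rw [lossP, h2NormSq_uniformDapi hs hb h0 hU hμ hα hk hγ hq hτ, mul_comm, ← nsmul_eq_mul,
    Fintype.card]
  refine Finset.sum_le_card_nsmul _ _ _ fun i _ => ?_
  have hB1 : ∀ v c, (uniformDapi b α k γ q τ ε).B (Sum.inr (Sum.inl v)) (Sum.inl c)
      = if v = c then τ⁻¹ else 0 := fun v c => by
    simp [uniformDapi, dapi, diagonal_apply]
  have hB2 : ∀ v c, (uniformDapi b α k γ q τ ε).B (Sum.inr (Sum.inr v)) (Sum.inl c) = 0 :=
    fun v c => rfl
  simp only [hB1, hB2, mul_zero, Finset.sum_const_zero, mul_ite, Finset.sum_ite_eq',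
    Finset.mem_univ, if_true]
  rcases (hμ i).eq_or_lt with hi | hi
  · simp [← hi]
  · set s := k * μ i with hs'
    set g := γ * μ i with hg'
    have hspos : 0 < s := by positivity
    have hgpos : 0 < g := by positivity
    have hdet := modeDet_pos hspos.le hgpos.le hq hτ
    have h1 : ∀ c, α * μ i * modeGramian s g q τ 0 (U c i * τ⁻¹) 0
        = α / (2 * k) * ((g * (τ * g + q) + q ^ 2 * s) / modeDet s g q τ) * U c i ^ 2 := by
      intro c
      rw [modeGramian_frequency hspos hgpos hq hτ]
      have : μ i = s / k := by rw [hs']; field_simp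
      rw [this]
      field_simp
    simp only [h1]
    rw [← ENNReal.ofReal_sum_of_nonneg fun c _ => by positivity, ← Finset.mul_sum, hU.sum_sq,
      mul_one]
    refine ENNReal.ofReal_le_ofReal (mul_le_of_le_one_right (by positivity) ?_)
    rw [div_le_one hdet, modeDet]
    have : 0 < g * τ := by positivity
    linarith

end Modal

/-! ### Comparison of the traces of pseudoinverses -/

section Comparison

variable {V : Type*} [Fintype V] [DecidableEq V]

/-- The trace of the pseudoinverse is antitone on positive semidefinite matrices with a common
kernel. As `0⁻¹ = 0`, the sum of the inverse eigenvalues is the trace of the pseudoinverse. -/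
theorem IsEigenbasis.sum_inv_le {A B W U : Matrix V V ℝ} {a b : V → ℝ} (hA : IsEigenbasis A W a)
    (hB : IsEigenbasis B U b) (ha : ∀ i, 0 ≤ a i) (hb : ∀ i, 0 ≤ b i) {C C' : ℝ} (hC : 0 ≤ C)
    (hAB : ∀ x, x ⬝ᵥ A *ᵥ x ≤ C * (x ⬝ᵥ B *ᵥ x)) (hBA : ∀ x, x ⬝ᵥ B *ᵥ x ≤ C' * (x ⬝ᵥ A *ᵥ x)) :
    ∑ j, (b j)⁻¹ ≤ C * ∑ i, (a i)⁻¹ := by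
  set P := Uᵀ * W with hP
  have hrow : ∀ j, ∑ i, P j i ^ 2 = 1 := by
    intro j
    have h : P * Pᵀ = 1 := by
      rw [hP, Matrix.transpose_mul, transpose_transpose, Matrix.mul_assoc, ← Matrix.mul_assoc W,
        hA.mul_transpose, Matrix.one_mul, hB.orthonormal]
    have := congrFun (congrFun h j) j
    simpa [Matrix.mul_apply, sq] using this
  have hterm : ∀ i, ∑ j, (b j)⁻¹ * P j i ^ 2 ≤ C * (a i)⁻¹ := by
    intro i
    have hcol : ∀ j, (Uᵀ *ᵥ fun v => W v i) j = P j i := fun j => rfl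
    have hnn : 0 ≤ ∑ j, (b j)⁻¹ * P j i ^ 2 :=
      Finset.sum_nonneg fun j _ => mul_nonneg (inv_nonneg.2 (hb j)) (sq_nonneg _)
    rcases (ha i).eq_or_lt with hi | hi
    · -- an eigenvector in the kernel of `A` lies in the kernel of `B`
      have h1 := hBA fun v => W v i
      rw [← hA.eigenvalue_eq, hB.dotProduct_mulVec, ← hi, mul_zero] at h1
      have h3 := (Finset.sum_eq_zero_iff_of_nonneg fun j _ =>
        mul_nonneg (hb j) (sq_nonneg ((Uᵀ *ᵥ fun v => W v i) j))).1 (le_antisymm h1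
          (Finset.sum_nonneg fun j _ => mul_nonneg (hb j) (sq_nonneg _)))
      have h4 : ∑ j, (b j)⁻¹ * P j i ^ 2 = 0 := by
        refine Finset.sum_eq_zero fun j _ => ?_
        rcases mul_eq_zero.1 (h3 j (Finset.mem_univ j)) with h | h
        · simp [h]
        · rw [← hcol, h, mul_zero]
      rw [h4, ← hi, _root_.inv_zero, mul_zero]
    · -- test the comparison on `y`, the pseudoinverse of `B` applied to the eigenvector
      set y : V → ℝ := U *ᵥ fun j => (b j)⁻¹ * P j i with hy
      have hUy : Uᵀ *ᵥ y = fun j => (b j)⁻¹ * P j i := by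
        rw [hy, mulVec_mulVec, hB.orthonormal, one_mulVec]
      have hWy : (Wᵀ *ᵥ y) i = ∑ j, (b j)⁻¹ * P j i ^ 2 := by
        have h : Wᵀ *ᵥ y = Pᵀ *ᵥ fun j => (b j)⁻¹ * P j i := by
          rw [hy, mulVec_mulVec, hP, Matrix.transpose_mul, transpose_transpose]
        rw [h]
        simp only [mulVec, dotProduct, transpose_apply]
        exact Finset.sum_congr rfl fun j _ => by ring
      have h1 := hAB y
      rw [hA.dotProduct_mulVec, hB.dotProduct_mulVec, hUy] at h1
      have h2 : ∑ j, b j * ((b j)⁻¹ * P j i) ^ 2 = ∑ j, (b j)⁻¹ * P j i ^ 2 := by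
        refine Finset.sum_congr rfl fun j _ => ?_
        rcases eq_or_ne (b j) 0 with h | h
        · simp [h]
        · field_simp
      have h3 : a i * (Wᵀ *ᵥ y) i ^ 2 ≤ ∑ l, a l * (Wᵀ *ᵥ y) l ^ 2 :=
        Finset.single_le_sum (f := fun l => a l * (Wᵀ *ᵥ y) l ^ 2)
          (fun l _ => mul_nonneg (ha l) (sq_nonneg _)) (Finset.mem_univ i)
      rw [h2] at h1
      rw [hWy] at h3
      have h4 := h3.trans h1
      rw [← div_eq_mul_inv, le_div_iff₀ hi]
      set S := ∑ j, (b j)⁻¹ * P j i ^ 2 with hS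
      rcases hnn.eq_or_lt with h0 | h0
      · rw [← h0, zero_mul]
        exact hC
      · refine le_of_mul_le_mul_right ?_ h0
        linarith
  calc ∑ j, (b j)⁻¹ = ∑ j, ∑ i, (b j)⁻¹ * P j i ^ 2 := by
        refine Finset.sum_congr rfl fun j _ => ?_
        rw [← Finset.mul_sum, hrow, mul_one]
    _ = ∑ i, ∑ j, (b j)⁻¹ * P j i ^ 2 := Finset.sum_comm
    _ ≤ ∑ i, C * (a i)⁻¹ := Finset.sum_le_sum fun i _ => hterm i
    _ = C * ∑ i, (a i)⁻¹ := by rw [Finset.mul_sum]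

end Comparison

/-! ### Fuzzes of graphs of bounded degree -/

section Fuzz

variable {V : Type*}

open Classical in
/-- The unit edge weights of a graph. -/
def adjWeight (G : SimpleGraph V) (u v : V) : ℝ := if G.Adj u v then 1 else 0

open Classical in
/-- The indicator of the pairs of nodes at distance at most `p`. -/
def nearWeight (G : SimpleGraph V) (p : ℕ) (u v : V) : ℝ := if G.edist u v ≤ p then 1 else 0

theorem adjWeight_eq_ite {G : SimpleGraph V} {u v : V} {P : Prop} [Decidable P]
    (h : G.Adj u v ↔ P) : adjWeight G u v = if P then 1 else 0 := by
  by_cases hP : P <;> simp [adjWeight, h, hP]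

theorem adjWeight_nonneg (G : SimpleGraph V) (u v : V) : 0 ≤ adjWeight G u v := by
  unfold adjWeight; split_ifs <;> norm_num

theorem nearWeight_nonneg (G : SimpleGraph V) (p : ℕ) (u v : V) : 0 ≤ nearWeight G p u v := by
  unfold nearWeight; split_ifs <;> norm_num

theorem adjWeight_symm (G : SimpleGraph V) (u v : V) : adjWeight G u v = adjWeight G v u := by
  classical
  rw [adjWeight_eq_ite (G.adj_comm u v), adjWeight_eq_ite Iff.rfl]

theorem adjWeight_self (G : SimpleGraph V) (u : V) : adjWeight G u u = 0 := by
  simp [adjWeight]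

variable [Fintype V]

/-- A path of length at most `p + 1` is shorter, or is an edge followed by a path of length at most
`p`. -/
theorem nearWeight_succ_mul_le (G : SimpleGraph V) (p : ℕ) (u v : V) {a : ℝ} {f : V → ℝ}
    (ha : 0 ≤ a) (hf : ∀ z, a ≤ f z) : nearWeight G (p + 1) u v * a
      ≤ nearWeight G p u v * a + ∑ z, adjWeight G u z * nearWeight G p z v * f z := by
  have hnn : ∀ z, 0 ≤ adjWeight G u z * nearWeight G p z v * f z := fun z =>
    mul_nonneg (mul_nonneg (adjWeight_nonneg _ _ _) (nearWeight_nonneg _ _ _ _)) (ha.trans (hf z))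
  have hnn' := Finset.sum_nonneg fun z (_ : z ∈ Finset.univ) => hnn z
  have hnn2 := mul_nonneg (nearWeight_nonneg G p u v) ha
  by_cases h : G.edist u v ≤ (p + 1 : ℕ)
  · have h1 : nearWeight G (p + 1) u v = 1 := if_pos h
    rw [h1, one_mul]
    obtain ⟨w, hw⟩ := SimpleGraph.exists_walk_of_edist_ne_top
      (ne_top_of_le_ne_top (ENat.natCast_ne_top _) h)
    rw [← hw] at h
    cases w with
    | nil =>
      have h2 : nearWeight G p u u = 1 := if_pos (by simp)
      rw [h2]
      linarith
    | @cons _ z _ hadj w =>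
      have h3 : w.length ≤ p := by
        have : w.length + 1 ≤ p + 1 := by exact_mod_cast h
        omega
      have h4 : nearWeight G p z v = 1 :=
        if_pos ((SimpleGraph.edist_le w).trans (by exact_mod_cast h3))
      have h5 : adjWeight G u z = 1 := if_pos hadj
      have h6 := Finset.single_le_sum (fun z _ => hnn z) (Finset.mem_univ z)
      rw [h4, h5, one_mul, one_mul] at h6
      linarith [hf z]
  · have h1 : nearWeight G (p + 1) u v = 0 := if_neg h
    rw [h1, zero_mul]
    positivity

theorem sum_nearWeight_le {G : SimpleGraph V} {Δ : ℝ} (hΔ : ∀ u, ∑ v, adjWeight G u v ≤ Δ)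
    (p : ℕ) (u : V) : ∑ v, nearWeight G p u v ≤ (1 + Δ) ^ p := by
  have hΔ0 : 0 ≤ Δ := (Finset.sum_nonneg fun v _ => adjWeight_nonneg G u v).trans (hΔ u)
  induction p generalizing u with
  | zero =>
    classical
    have h : ∀ v, nearWeight G 0 u v = if u = v then 1 else 0 := fun v => by
      simp [nearWeight]
    simp [h]
  | succ p ih =>
    have h : ∀ v, nearWeight G (p + 1) u v
        ≤ nearWeight G p u v + ∑ z, adjWeight G u z * nearWeight G p z v := fun v => by
      simpa using nearWeight_succ_mul_le G p u v zero_le_one fun _ => le_rfl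
    calc ∑ v, nearWeight G (p + 1) u v
        ≤ ∑ v, (nearWeight G p u v + ∑ z, adjWeight G u z * nearWeight G p z v) :=
          Finset.sum_le_sum fun v _ => h v
      _ = ∑ v, nearWeight G p u v + ∑ z, adjWeight G u z * ∑ v, nearWeight G p z v := by
          rw [Finset.sum_add_distrib, Finset.sum_comm]
          simp only [Finset.mul_sum]
      _ ≤ (1 + Δ) ^ p + ∑ z, adjWeight G u z * (1 + Δ) ^ p := by
          gcongr with z
          · exact ih u
          · exact adjWeight_nonneg G u z
          · exact ih z
      _ ≤ (1 + Δ) ^ p + Δ * (1 + Δ) ^ p := by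
          rw [← Finset.sum_mul]
          gcongr
          exact hΔ u
      _ = (1 + Δ) ^ (p + 1) := by ring

/-- A bound for the ratio of the energies of the `p`-fuzz and of a graph of degree at most `Δ`. -/
def fuzzConst (Δ : ℝ) : ℕ → ℝ
  | 0 => 0
  | p + 1 => (1 + 2 * Δ) * fuzzConst Δ p + 2 * (1 + Δ) ^ p

theorem fuzzConst_nonneg {Δ : ℝ} (hΔ : 0 ≤ Δ) (p : ℕ) : 0 ≤ fuzzConst Δ p := by
  induction p with
  | zero => exact le_rfl
  | succ p ih => unfold fuzzConst; positivity

theorem energy_nearWeight_le {G : SimpleGraph V} {Δ : ℝ} (hΔ0 : 0 ≤ Δ)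
    (hΔ : ∀ u, ∑ v, adjWeight G u v ≤ Δ) (p : ℕ) (x : V → ℝ) :
    energy (nearWeight G p) x ≤ fuzzConst Δ p * energy (adjWeight G) x := by
  induction p with
  | zero =>
    have h : energy (nearWeight G 0) x = 0 := by
      refine Finset.sum_eq_zero fun u _ => Finset.sum_eq_zero fun v _ => ?_
      by_cases huv : u = v
      · simp [huv]
      · simp [nearWeight, huv]
    rw [h, fuzzConst, zero_mul]
  | succ p ih =>
    have hE0 := energy_nonneg (nearWeight_nonneg G p) x
    have hE1 := energy_nonneg (adjWeight_nonneg G) x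
    -- `(x u - x v)² ≤ 2 (x u - x z)² + 2 (x z - x v)²` for an intermediate node `z`
    have hstep : ∀ u v, nearWeight G (p + 1) u v * (x u - x v) ^ 2
        ≤ nearWeight G p u v * (x u - x v) ^ 2 + ∑ z, adjWeight G u z * nearWeight G p z v *
          (2 * (x u - x z) ^ 2 + 2 * (x z - x v) ^ 2) := fun u v =>
      nearWeight_succ_mul_le G p u v (sq_nonneg _) fun z => by
        nlinarith [sq_nonneg ((x u - x z) - (x z - x v))]
    have h1 : ∑ u, ∑ v, ∑ z, adjWeight G u z * nearWeight G p z v *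
          (2 * (x u - x z) ^ 2 + 2 * (x z - x v) ^ 2)
        = 2 * ∑ u, ∑ z, adjWeight G u z * (x u - x z) ^ 2 * ∑ v, nearWeight G p z v
          + 2 * ∑ z, ∑ v, nearWeight G p z v * (x z - x v) ^ 2 * ∑ u, adjWeight G z u := by
      have e1 : ∀ u, ∑ v, ∑ z, adjWeight G u z * nearWeight G p z v *
          (2 * (x u - x z) ^ 2 + 2 * (x z - x v) ^ 2)
        = ∑ z, 2 * (adjWeight G u z * (x u - x z) ^ 2 * ∑ v, nearWeight G p z v)
          + ∑ z, ∑ v, 2 * (nearWeight G p z v * (x z - x v) ^ 2 * adjWeight G u z) := by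
        intro u
        rw [Finset.sum_comm, ← Finset.sum_add_distrib]
        refine Finset.sum_congr rfl fun z _ => ?_
        rw [Finset.mul_sum, Finset.mul_sum, ← Finset.sum_add_distrib]
        exact Finset.sum_congr rfl fun v _ => by ring
      have e2 : ∑ u, ∑ z, ∑ v, 2 * (nearWeight G p z v * (x z - x v) ^ 2 * adjWeight G u z)
          = ∑ z, ∑ v, 2 * (nearWeight G p z v * (x z - x v) ^ 2 * ∑ u, adjWeight G z u) := by
        rw [Finset.sum_comm]
        refine Finset.sum_congr rfl fun z _ => ?_
        rw [Finset.sum_comm]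
        refine Finset.sum_congr rfl fun v _ => ?_
        rw [Finset.mul_sum, Finset.mul_sum]
        exact Finset.sum_congr rfl fun u _ => by rw [adjWeight_symm]
      simp only [e1, Finset.sum_add_distrib]
      rw [e2]
      simp only [Finset.mul_sum (a := (2 : ℝ))]
    calc energy (nearWeight G (p + 1)) x
        ≤ ∑ u, ∑ v, (nearWeight G p u v * (x u - x v) ^ 2 + ∑ z, adjWeight G u z *
          nearWeight G p z v * (2 * (x u - x z) ^ 2 + 2 * (x z - x v) ^ 2)) :=
          Finset.sum_le_sum fun u _ => Finset.sum_le_sum fun v _ => hstep u v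
      _ = energy (nearWeight G p) x
          + (2 * ∑ u, ∑ z, adjWeight G u z * (x u - x z) ^ 2 * ∑ v, nearWeight G p z v
          + 2 * ∑ z, ∑ v, nearWeight G p z v * (x z - x v) ^ 2 * ∑ u, adjWeight G z u) := by
          simp only [Finset.sum_add_distrib, h1, energy]
      _ ≤ energy (nearWeight G p) x
          + (2 * ∑ u, ∑ z, adjWeight G u z * (x u - x z) ^ 2 * (1 + Δ) ^ p
          + 2 * ∑ z, ∑ v, nearWeight G p z v * (x z - x v) ^ 2 * Δ) := by
          gcongr with u _ z _ z _ v _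
          · exact mul_nonneg (adjWeight_nonneg _ _ _) (sq_nonneg _)
          · exact sum_nearWeight_le hΔ p z
          · exact mul_nonneg (nearWeight_nonneg _ _ _ _) (sq_nonneg _)
          · exact hΔ z
      _ = (1 + 2 * Δ) * energy (nearWeight G p) x + 2 * (1 + Δ) ^ p * energy (adjWeight G) x := by
          simp only [← Finset.sum_mul, energy]
          ring
      _ ≤ (1 + 2 * Δ) * (fuzzConst Δ p * energy (adjWeight G) x)
          + 2 * (1 + Δ) ^ p * energy (adjWeight G) x := by gcongr
      _ = fuzzConst Δ (p + 1) * energy (adjWeight G) x := by rw [fuzzConst]; ring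

theorem energy_adjWeight_le {G : SimpleGraph V} {Δ : ℝ}
    (hΔ : ∀ u, ∑ v, adjWeight G u v ≤ Δ) (x : V → ℝ) :
    energy (adjWeight G) x ≤ 4 * Δ * (x ⬝ᵥ x) := by
  have h1 : ∑ u, ∑ v, adjWeight G u v * (2 * x v ^ 2)
      = ∑ u, ∑ v, adjWeight G u v * (2 * x u ^ 2) := by
    rw [Finset.sum_comm]
    exact Finset.sum_congr rfl fun u _ => Finset.sum_congr rfl fun v _ => by rw [adjWeight_symm]
  calc energy (adjWeight G) x
      ≤ ∑ u, ∑ v, (adjWeight G u v * (2 * x u ^ 2) + adjWeight G u v * (2 * x v ^ 2)) := by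
        refine Finset.sum_le_sum fun u _ => Finset.sum_le_sum fun v _ => ?_
        rw [← mul_add]
        refine mul_le_mul_of_nonneg_left ?_ (adjWeight_nonneg _ _ _)
        nlinarith [sq_nonneg (x u + x v)]
    _ = ∑ u, (∑ v, adjWeight G u v) * (4 * x u ^ 2) := by
        simp only [Finset.sum_add_distrib, h1]
        simp only [← Finset.sum_add_distrib, Finset.sum_mul]
        exact Finset.sum_congr rfl fun u _ => Finset.sum_congr rfl fun v _ => by ring
    _ ≤ ∑ u, Δ * (4 * x u ^ 2) := by
        gcongr with u
        exact hΔ u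
    _ = 4 * Δ * (x ⬝ᵥ x) := by
        simp only [dotProduct, Finset.mul_sum]
        exact Finset.sum_congr rfl fun u _ => by ring

end Fuzz

/-! ### Losses due to measurement noise on bounded-degree graphs -/

section Bounds

variable {V : Type*} {G : SimpleGraph V} {b : V → V → ℝ}

theorem IsEdgeWeight.nonneg (h : IsEdgeWeight G b) (i j : V) : 0 ≤ b i j := by
  by_cases hij : G.Adj i j
  · exact (h.pos_of_adj i j hij).le
  · exact (h.eq_zero_of_not_adj i j hij).ge

theorem IsEdgeWeight.self (h : IsEdgeWeight G b) (i : V) : b i i = 0 :=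
  h.eq_zero_of_not_adj i i (SimpleGraph.irrefl _)

theorem IsBoundedEdgeWeight.le_nearWeight {p : ℕ} {bmin bmax : ℝ} (hbmax : 0 ≤ bmax)
    (h : IsBoundedEdgeWeight (G.fuzz p) bmin bmax b) (i j : V) :
    b i j ≤ bmax * nearWeight G p i j := by
  by_cases hij : (G.fuzz p).Adj i j
  · have : nearWeight G p i j = 1 := if_pos hij.2
    rw [this, mul_one]
    exact (h.2 i j hij).2
  · rw [h.1.eq_zero_of_not_adj i j hij]
    exact mul_nonneg hbmax (nearWeight_nonneg _ _ _ _)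

theorem IsBoundedEdgeWeight.adjWeight_le {p : ℕ} (hp : 1 ≤ p) {bmin bmax : ℝ}
    (h : IsBoundedEdgeWeight (G.fuzz p) bmin bmax b) (i j : V) :
    bmin * adjWeight G i j ≤ b i j := by
  by_cases hij : G.Adj i j
  · have h1 : adjWeight G i j = 1 := if_pos hij
    have h2 : (G.fuzz p).Adj i j := by
      refine ⟨hij.ne, ?_⟩
      rw [SimpleGraph.edist_eq_one_iff_adj.2 hij]
      exact_mod_cast hp
    rw [h1, mul_one]
    exact (h.2 i j h2).1
  · have h1 : adjWeight G i j = 0 := if_neg hij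
    rw [h1, mul_zero]
    exact h.1.nonneg i j

variable [Fintype V] [DecidableEq V]

theorem IsEigenbasis.eigenvalue_nonneg (h0 : IsEdgeWeight G b) {U : Matrix V V ℝ} {μ : V → ℝ}
    (h : IsEigenbasis (laplacian b) U μ) (i : V) : 0 ≤ μ i := by
  rw [h.eigenvalue_eq, dotProduct_laplacian h0.symm h0.self]
  have := energy_nonneg h0.nonneg fun v => U v i
  positivity

theorem modeLoss_le {α k γ q τ x : ℝ} (hα : 0 < α) (hk : 0 < k) (hγ : 0 < γ) (hq : 0 < q)
    (hτ : 0 < τ) (hx : 0 ≤ x) : modeLoss α k γ q τ x ≤ α / (2 * k * γ) * x⁻¹ := by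
  rcases hx.eq_or_lt with rfl | hx
  · simp [modeLoss]
  · have hdet := modeDet_pos (s := k * x) (g := γ * x) (by positivity) (by positivity) hq hτ
    have h1 : (q + τ * (γ * x)) / modeDet (k * x) (γ * x) q τ ≤ 1 := by
      rw [div_le_one hdet, modeDet]
      have : 0 ≤ γ * x * q + q ^ 2 * (k * x) + τ * (γ * x) ^ 2 := by positivity
      linarith
    calc modeLoss α k γ q τ x
        = α / (2 * k * γ) * x⁻¹ * ((q + τ * (γ * x)) / modeDet (k * x) (γ * x) q τ) := by
          unfold modeLoss; field_simp
      _ ≤ α / (2 * k * γ) * x⁻¹ := mul_le_of_le_one_right (by positivity) h1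

theorem le_modeLoss {α k γ q τ x Λ : ℝ} (hα : 0 < α) (hk : 0 < k) (hγ : 0 < γ) (hq : 0 < q)
    (hτ : 0 < τ) (hx : 0 ≤ x) (hΛ : x ≤ Λ) :
    α / (2 * k * γ) * (q / modeDet (k * Λ) (γ * Λ) q τ) * x⁻¹ ≤ modeLoss α k γ q τ x := by
  rcases hx.eq_or_lt with rfl | hx
  · simp [modeLoss]
  · have hdet := modeDet_pos (s := k * x) (g := γ * x) (by positivity) (by positivity) hq hτ
    have h1 : q / modeDet (k * Λ) (γ * Λ) q τ
        ≤ (q + τ * (γ * x)) / modeDet (k * x) (γ * x) q τ := by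
      have : 0 < τ * (γ * x) := by positivity
      refine div_le_div₀ (by positivity) (by linarith) hdet ?_
      unfold modeDet
      gcongr
    calc α / (2 * k * γ) * (q / modeDet (k * Λ) (γ * Λ) q τ) * x⁻¹
        ≤ α / (2 * k * γ) * ((q + τ * (γ * x)) / modeDet (k * x) (γ * x) q τ) * x⁻¹ := by gcongr
      _ = modeLoss α k γ q τ x := by unfold modeLoss; field_simp

/-- On the `p`-fuzz of a graph of bounded degree, the losses due to measurement noise are comparable
to the trace of the pseudoinverse of the unweighted Laplacian of the graph itself. -/
theorem exists_lossEta_bounds {α k γ q τ bmin bmax Δ : ℝ} {p : ℕ}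
    (hα : 0 < α) (hk : 0 < k) (hγ : 0 < γ) (hq : 0 < q) (hτ : 0 < τ)
    (hbmin : 0 < bmin) (hb : bmin ≤ bmax) (hp : 1 ≤ p) (hΔ0 : 0 ≤ Δ) :
    ∃ c C : ℝ, 0 < c ∧ 0 < C ∧ ∀ (V : Type) [Fintype V] [DecidableEq V] (G : SimpleGraph V)
      (U : Matrix V V ℝ) (μ : V → ℝ), IsEigenbasis (laplacian (adjWeight G)) U μ →
      (∀ u, ∑ v, adjWeight G u v ≤ Δ) →
      ∀ b : V → V → ℝ, IsBoundedEdgeWeight (G.fuzz p) bmin bmax b → ∀ ε : ℝ,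
        ENNReal.ofReal (c * (ε ^ 2 * ∑ i, (μ i)⁻¹)) ≤ lossEta b α k γ q τ ε ∧
        lossEta b α k γ q τ ε ≤ ENNReal.ofReal (C * (ε ^ 2 * ∑ i, (μ i)⁻¹)) := by
  have hbmax : 0 < bmax := hbmin.trans_le hb
  set K := bmax * (fuzzConst Δ p + 1) with hK
  have hfc := fuzzConst_nonneg hΔ0 p
  have hKpos : 0 < K := by positivity
  set Λ := K * (2 * Δ) with hΛ
  have hdet := modeDet_pos (s := k * Λ) (g := γ * Λ) (by positivity) (by positivity) hq hτ
  set m := α / (2 * k * γ) * (q / modeDet (k * Λ) (γ * Λ) q τ) with hm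
  have hmpos : 0 < m := by positivity
  refine ⟨m * K⁻¹, α / (2 * k * γ) * bmin⁻¹, by positivity, by positivity, ?_⟩
  intro V _ _ G U₀ μ hU₀ hΔ b hbG ε
  have hadj : IsEdgeWeight G (adjWeight G) :=
    ⟨adjWeight_symm G, fun i j h => by simp [adjWeight, h], fun i j h => by simp [adjWeight, h]⟩
  have hs := hbG.1.symm
  have h0 := hbG.1.nonneg
  have hself := hbG.1.self
  obtain ⟨U, lam, hU⟩ := exists_isEigenbasis (posSemidef_laplacian hs hself h0).isHermitian
  have hlam := hU.eigenvalue_nonneg hbG.1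
  have hμ := hU₀.eigenvalue_nonneg hadj
  have hup : ∀ x, x ⬝ᵥ laplacian b *ᵥ x ≤ K * (x ⬝ᵥ laplacian (adjWeight G) *ᵥ x) := by
    intro x
    rw [dotProduct_laplacian hs hself, dotProduct_laplacian hadj.symm hadj.self]
    have h1 := energy_mono (hbG.le_nearWeight hbmax.le) x
    rw [energy_const_mul] at h1
    have h2 := energy_nearWeight_le hΔ0 hΔ p x
    have h3 := energy_nonneg hadj.nonneg x
    have h4 := mul_le_mul_of_nonneg_left h2 hbmax.le
    have h5 : 0 ≤ bmax * energy (adjWeight G) x := by positivity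
    rw [hK]
    linarith
  have hlow : ∀ x, x ⬝ᵥ laplacian (adjWeight G) *ᵥ x ≤ bmin⁻¹ * (x ⬝ᵥ laplacian b *ᵥ x) := by
    intro x
    rw [dotProduct_laplacian hs hself, dotProduct_laplacian hadj.symm hadj.self]
    have h1 := energy_mono (hbG.adjWeight_le hp) x
    rw [energy_const_mul] at h1
    rw [← div_eq_inv_mul, le_div_iff₀ hbmin]
    linarith
  have hle : ∀ i, lam i ≤ Λ := by
    intro i
    have h1 := hup fun v => U v i
    rw [← hU.eigenvalue_eq, dotProduct_laplacian hadj.symm hadj.self] at h1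
    have h2 := energy_adjWeight_le hΔ fun v => U v i
    have h3 : (fun v => U v i) ⬝ᵥ (fun v => U v i) = 1 := by
      rw [← hU.sum_sq i]
      simp only [dotProduct, sq]
    rw [h3, mul_one] at h2
    refine h1.trans ?_
    rw [hΛ]
    gcongr
    linarith
  have h1 := hU.sum_inv_le hU₀ hlam hμ hKpos.le hup hlow
  have h2 := hU₀.sum_inv_le hU hμ hlam (inv_nonneg.2 hbmin.le) hlow hup
  rw [lossEta_eq hs hself h0 hU hlam hα hk hγ hq hτ]
  constructor
  · refine ENNReal.ofReal_le_ofReal ?_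
    calc m * K⁻¹ * (ε ^ 2 * ∑ i, (μ i)⁻¹) ≤ m * K⁻¹ * (ε ^ 2 * (K * ∑ i, (lam i)⁻¹)) := by gcongr
      _ = ε ^ 2 * ∑ i, m * (lam i)⁻¹ := by rw [← Finset.mul_sum]; field_simp
      _ ≤ _ := by
        gcongr with i
        exact le_modeLoss hα hk hγ hq hτ (hlam i) (hle i)
  · refine ENNReal.ofReal_le_ofReal ?_
    calc ε ^ 2 * ∑ i, modeLoss α k γ q τ (lam i)
        ≤ ε ^ 2 * ∑ i, α / (2 * k * γ) * (lam i)⁻¹ := by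
          gcongr with i
          exact modeLoss_le hα hk hγ hq hτ (hlam i)
      _ = α / (2 * k * γ) * (ε ^ 2 * ∑ i, (lam i)⁻¹) := by rw [← Finset.mul_sum]; ring
      _ ≤ α / (2 * k * γ) * (ε ^ 2 * (bmin⁻¹ * ∑ i, (μ i)⁻¹)) := by gcongr
      _ = _ := by ring

end Bounds

/-! ### Eigenbases of path and lattice Laplacians -/

section Lattice

/-- Eigenvectors of a symmetric matrix for distinct eigenvalues are orthogonal, so it remains to
normalize them. -/
theorem exists_isEigenbasis_of_injective {V : Type*} [Fintype V] [DecidableEq V]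
    {M : Matrix V V ℝ} (hM : Mᵀ = M) {e : V → V → ℝ} {μ : V → ℝ} (he : ∀ k, e k ≠ 0)
    (hμ : Function.Injective μ) (h : ∀ k, M *ᵥ e k = μ k • e k) :
    ∃ U : Matrix V V ℝ, IsEigenbasis M U μ := by
  have horth : ∀ k l, k ≠ l → e k ⬝ᵥ e l = 0 := by
    intro k l hkl
    have h1 : (M *ᵥ e k) ⬝ᵥ e l = e k ⬝ᵥ M *ᵥ e l := by
      rw [Matrix.dotProduct_mulVec, ← mulVec_transpose, hM]
    rw [h, h, smul_dotProduct, dotProduct_smul, smul_eq_mul, smul_eq_mul] at h1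
    have h2 : (μ k - μ l) * (e k ⬝ᵥ e l) = 0 := by linarith
    exact (mul_eq_zero.1 h2).resolve_left (sub_ne_zero.2 fun hh => hkl (hμ hh))
  have hpos : ∀ k, 0 < e k ⬝ᵥ e k := fun k => by
    have h0 : e k ⬝ᵥ e k ≠ 0 := fun h0 => he k (dotProduct_self_eq_zero.1 h0)
    exact lt_of_le_of_ne (Finset.sum_nonneg fun v _ => mul_self_nonneg _) h0.symm
  refine ⟨Matrix.of fun v k => (√(e k ⬝ᵥ e k))⁻¹ * e k v, ?_, ?_⟩
  · ext k l
    have h1 : ((Matrix.of fun v k => (√(e k ⬝ᵥ e k))⁻¹ * e k v)ᵀ *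
        (Matrix.of fun v k => (√(e k ⬝ᵥ e k))⁻¹ * e k v)) k l
        = (√(e k ⬝ᵥ e k))⁻¹ * (√(e l ⬝ᵥ e l))⁻¹ * (e k ⬝ᵥ e l) := by
      rw [Matrix.mul_apply, dotProduct.eq_1 (e k) (e l), Finset.mul_sum]
      exact Finset.sum_congr rfl fun v _ => by simp only [transpose_apply, of_apply]; ring
    rw [h1, Matrix.one_apply]
    split_ifs with hkl
    · subst hkl
      rw [← mul_inv, Real.mul_self_sqrt (hpos k).le, inv_mul_cancel₀ (hpos k).ne']
    · rw [horth k l hkl, mul_zero]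
  · ext v k
    rw [mul_diagonal]
    have h1 := congrFun (h k) v
    simp only [mulVec, dotProduct, Pi.smul_apply, smul_eq_mul] at h1
    rw [Matrix.mul_apply]
    simp only [of_apply]
    calc ∑ j, M v j * ((√(e k ⬝ᵥ e k))⁻¹ * e k j)
        = (√(e k ⬝ᵥ e k))⁻¹ * ∑ j, M v j * e k j := by
          rw [Finset.mul_sum]
          exact Finset.sum_congr rfl fun j _ => by ring
      _ = _ := by rw [h1]; ring

theorem sum_adjWeight_pathGraph_mul (n : ℕ) (i : Fin n) (g : Fin n → ℝ) :
    ∑ j, adjWeight (SimpleGraph.pathGraph n) i j * g j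
      = (∑ j : Fin n, if (j : ℕ) + 1 = i then g j else 0)
        + ∑ j : Fin n, if (i : ℕ) + 1 = j then g j else 0 := by
  rw [← Finset.sum_add_distrib]
  refine Finset.sum_congr rfl fun j _ => ?_
  have h : adjWeight (SimpleGraph.pathGraph n) i j
      = if ((i : ℕ) + 1 = j ∨ (j : ℕ) + 1 = i) then 1 else 0 :=
    adjWeight_eq_ite SimpleGraph.pathGraph_adj
  rw [h]
  by_cases h1 : (i : ℕ) + 1 = j
  · have h2 : ¬ (j : ℕ) + 1 = i := by omega
    simp [h1, h2]
  · by_cases h2 : (j : ℕ) + 1 = i <;> simp [h1, h2]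

theorem sum_ite_pred {n : ℕ} (i : Fin n) (g : ℝ → ℝ) (h0 : g (-1) = 0) :
    (∑ j : Fin n, if (j : ℕ) + 1 = i then g j else 0) = g (i - 1) := by
  obtain ⟨i, hi⟩ := i
  cases i with
  | zero => simp [h0]
  | succ m =>
    rw [Finset.sum_eq_single ⟨m, by omega⟩]
    · simp
    · intro j _ hj
      rw [if_neg]
      intro h
      exact hj (Fin.ext (by simpa using h))
    · simp

theorem sum_ite_succ {n : ℕ} (i : Fin n) (g : ℝ → ℝ) (hn : g n = 0) :
    (∑ j : Fin n, if (i : ℕ) + 1 = j then g j else 0) = g (i + 1) := by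
  by_cases hi : (i : ℕ) + 1 < n
  · rw [Finset.sum_eq_single ⟨i + 1, hi⟩]
    · simp
    · intro j _ hj
      rw [if_neg]
      intro h
      exact hj (Fin.ext h.symm)
    · simp
  · have h1 : (i : ℕ) + 1 = n := by omega
    have h2 : ((i : ℕ) : ℝ) + 1 = n := by exact_mod_cast h1
    rw [h2, hn]
    refine Finset.sum_eq_zero fun j _ => if_neg ?_
    have := j.2
    omega

/-- The `k`-th eigenvalue of the Laplacian of the path with `n` nodes. -/
def pathEigenvalue (n k : ℕ) : ℝ := 2 - 2 * Real.cos (Real.pi * k / n)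

/-- The eigenvectors are the vectors `i ↦ cos (π k (i + 1/2) / n)`: extended to all integers they
are symmetric about the two ends of the path, so that the boundary terms of the Laplacian vanish. -/
theorem exists_isEigenbasis_pathGraph (n : ℕ) :
    ∃ U, IsEigenbasis (laplacian (adjWeight (SimpleGraph.pathGraph n))) U
      fun k : Fin n => pathEigenvalue n k := by
  rcases Nat.eq_zero_or_pos n with rfl | hn
  · exact ⟨0, by ext i; exact i.elim0, by ext i; exact i.elim0⟩
  have hn' : (0 : ℝ) < n := by exact_mod_cast hn
  have hang : ∀ k : Fin n, 0 ≤ Real.pi * (k : ℕ) / n ∧ Real.pi * (k : ℕ) / n < Real.pi := by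
    intro k
    refine ⟨by positivity, ?_⟩
    rw [div_lt_iff₀ hn']
    have : ((k : ℕ) : ℝ) < n := by exact_mod_cast k.2
    gcongr
  set f : ℕ → ℝ → ℝ := fun k t => Real.cos (Real.pi * k / n * (t + 1 / 2)) with hf
  refine exists_isEigenbasis_of_injective (e := fun k i : Fin n => f k (i : ℕ))
    (laplacian_transpose (adjWeight_symm _)) ?_ ?_ ?_
  · intro k h0
    have h1 : f k ((0 : ℕ) : ℝ) = 0 := congrFun h0 ⟨0, hn⟩
    obtain ⟨h2, h3⟩ := hang k
    have h4 : 0 < f k ((0 : ℕ) : ℝ) := by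
      refine Real.cos_pos_of_mem_Ioo ⟨?_, ?_⟩
      · push_cast
        linarith [Real.pi_pos]
      · push_cast
        linarith
    exact h4.ne' h1
  · intro k l hkl
    have h1 : Real.cos (Real.pi * (k : ℕ) / n) = Real.cos (Real.pi * (l : ℕ) / n) := by
      simp only [pathEigenvalue] at hkl
      linarith
    have h2 := Real.injOn_cos ⟨(hang k).1, (hang k).2.le⟩ ⟨(hang l).1, (hang l).2.le⟩ h1
    have h3 : ((k : ℕ) : ℝ) = (l : ℕ) := by
      have := Real.pi_pos.ne'
      field_simp at h2
      exact h2
    exact Fin.ext (by exact_mod_cast h3)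
  · intro k
    ext i
    rw [laplacian_mulVec_apply (adjWeight_self _), sum_adjWeight_pathGraph_mul]
    have hm1 : f k (-1) = f k 0 := by
      simp only [hf]
      rw [← Real.cos_neg]
      congr 1
      ring
    have hnn : f k n = f k (n - 1) := by
      simp only [hf]
      have e1 : Real.pi * (k : ℕ) / n * ((n : ℝ) + 1 / 2)
          = (k : ℕ) * Real.pi + Real.pi * (k : ℕ) / n / 2 := by field_simp
      have e2 : Real.pi * (k : ℕ) / n * ((n : ℝ) - 1 + 1 / 2)
          = (k : ℕ) * Real.pi - Real.pi * (k : ℕ) / n / 2 := by field_simp; ring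
      rw [e1, e2, Real.cos_add, Real.cos_sub, Real.sin_nat_mul_pi]
      ring
    have h1 : (∑ j : Fin n, if (j : ℕ) + 1 = i then f k (i : ℕ) - f k (j : ℕ) else 0)
        = f k (i : ℕ) - f k ((i : ℕ) - 1) := by
      have := sum_ite_pred i (fun t => f k (t + 1) - f k t) (by simp [hm1])
      simp only [sub_add_cancel] at this
      rw [← this]
      refine Finset.sum_congr rfl fun j _ => ?_
      split_ifs with h
      · have : ((i : ℕ) : ℝ) = (j : ℕ) + 1 := by exact_mod_cast h.symm
        rw [this]
      · rfl
    have h2 : (∑ j : Fin n, if (i : ℕ) + 1 = j then f k (i : ℕ) - f k (j : ℕ) else 0)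
        = f k (i : ℕ) - f k ((i : ℕ) + 1) := by
      have := sum_ite_succ i (fun t => f k (t - 1) - f k t) (by simp [hnn])
      simp only [add_sub_cancel_right] at this
      rw [← this]
      refine Finset.sum_congr rfl fun j _ => ?_
      split_ifs with h
      · have : ((j : ℕ) : ℝ) = (i : ℕ) + 1 := by exact_mod_cast h.symm
        rw [this, add_sub_cancel_right]
      · rfl
    rw [h1, h2, Pi.smul_apply, smul_eq_mul, pathEigenvalue]
    simp only [hf]
    set a := Real.pi * (k : ℕ) / n with ha
    have e1 : a * ((i : ℕ) - 1 + 1 / 2) = a * ((i : ℕ) + 1 / 2) - a := by ring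
    have e2 : a * ((i : ℕ) + 1 + 1 / 2) = a * ((i : ℕ) + 1 / 2) + a := by ring
    rw [e1, e2, Real.cos_add, Real.cos_sub]
    ring

theorem sum_adjWeight_pathGraph_le (n : ℕ) (i : Fin n) :
    ∑ j, adjWeight (SimpleGraph.pathGraph n) i j ≤ 2 := by
  have h := sum_adjWeight_pathGraph_mul n i fun _ => 1
  simp only [mul_one] at h
  have h1 : (∑ j : Fin n, if (j : ℕ) + 1 = i then (1 : ℝ) else 0) ≤ 1 := by
    rw [Finset.sum_boole]
    refine Nat.cast_le_one.2 (Finset.card_le_one.2 ?_)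
    intro a ha b hb
    simp only [Finset.mem_filter, Finset.mem_univ, true_and] at ha hb
    exact Fin.ext (by omega)
  have h2 : (∑ j : Fin n, if (i : ℕ) + 1 = j then (1 : ℝ) else 0) ≤ 1 := by
    rw [Finset.sum_boole]
    refine Nat.cast_le_one.2 (Finset.card_le_one.2 ?_)
    intro a ha b hb
    simp only [Finset.mem_filter, Finset.mem_univ, true_and] at ha hb
    exact Fin.ext (by omega)
  linarith

section BoxProd

variable {V₁ V₂ : Type*} [Fintype V₁] [Fintype V₂]

theorem sum_adjWeight_boxProd_mul (G : SimpleGraph V₁) (H : SimpleGraph V₂) (x : V₁ × V₂)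
    (g : V₁ × V₂ → ℝ) :
    ∑ y, adjWeight (G.boxProd H) x y * g y
      = ∑ i, adjWeight G x.1 i * g (i, x.2) + ∑ j, adjWeight H x.2 j * g (x.1, j) := by
  classical
  have h : ∀ y : V₁ × V₂, adjWeight (G.boxProd H) x y * g y
      = (if y.2 = x.2 then adjWeight G x.1 y.1 * g y else 0)
        + if y.1 = x.1 then adjWeight H x.2 y.2 * g y else 0 := by
    intro y
    have h1 : adjWeight (G.boxProd H) x y
        = if (G.Adj x.1 y.1 ∧ x.2 = y.2 ∨ H.Adj x.2 y.2 ∧ x.1 = y.1) then 1 else 0 :=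
      adjWeight_eq_ite SimpleGraph.boxProd_adj
    rw [h1]
    by_cases h2 : x.2 = y.2
    · simp [h2, adjWeight]
    · by_cases h3 : x.1 = y.1
      · simp [h2, h3, Ne.symm h2, adjWeight]
      · simp [h2, h3, Ne.symm h2, Ne.symm h3]
  simp only [h, Finset.sum_add_distrib, Fintype.sum_prod_type]
  congr 1
  · simp
  · rw [Finset.sum_comm]
    simp

variable [DecidableEq V₁] [DecidableEq V₂]

/-- The products of the eigenvectors of two graphs form an eigenbasis of the box product. -/
theorem IsEigenbasis.boxProd {G : SimpleGraph V₁} {H : SimpleGraph V₂} {U₁ : Matrix V₁ V₁ ℝ}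
    {U₂ : Matrix V₂ V₂ ℝ} {μ : V₁ → ℝ} {ν : V₂ → ℝ}
    (h₁ : IsEigenbasis (laplacian (adjWeight G)) U₁ μ)
    (h₂ : IsEigenbasis (laplacian (adjWeight H)) U₂ ν) :
    IsEigenbasis (laplacian (adjWeight (G.boxProd H))) (kroneckerMap (· * ·) U₁ U₂)
      fun k => μ k.1 + ν k.2 := by
  constructor
  · have h := Matrix.mul_kronecker_mul U₁ᵀ U₁ U₂ᵀ U₂
    rw [h₁.orthonormal, h₂.orthonormal, Matrix.one_kronecker_one] at h
    exact h.symm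
  · ext x k
    have e1 := congrFun (congrFun h₁.mul_eq x.1) k.1
    have e2 := congrFun (congrFun h₂.mul_eq x.2) k.2
    rw [mul_diagonal] at e1 e2 ⊢
    have e1' : ∑ i, adjWeight G x.1 i * (U₁ x.1 k.1 - U₁ i k.1) = U₁ x.1 k.1 * μ k.1 := by
      rw [← e1]
      exact (laplacian_mulVec_apply (adjWeight_self G) (fun v => U₁ v k.1) x.1).symm
    have e2' : ∑ j, adjWeight H x.2 j * (U₂ x.2 k.2 - U₂ j k.2) = U₂ x.2 k.2 * ν k.2 := by
      rw [← e2]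
      exact (laplacian_mulVec_apply (adjWeight_self H) (fun v => U₂ v k.2) x.2).symm
    have e3 := laplacian_mulVec_apply (adjWeight_self (G.boxProd H))
      (fun v => U₁ v.1 k.1 * U₂ v.2 k.2) x
    rw [sum_adjWeight_boxProd_mul] at e3
    refine e3.trans ?_
    simp only [kroneckerMap_apply]
    calc _ = (∑ i, adjWeight G x.1 i * (U₁ x.1 k.1 - U₁ i k.1)) * U₂ x.2 k.2
          + (∑ j, adjWeight H x.2 j * (U₂ x.2 k.2 - U₂ j k.2)) * U₁ x.1 k.1 := by
          rw [Finset.sum_mul, Finset.sum_mul]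
          congr 1
          · exact Finset.sum_congr rfl fun i _ => by ring
          · exact Finset.sum_congr rfl fun i _ => by ring
      _ = _ := by rw [e1', e2']; ring

end BoxProd

theorem sum_adjWeight_lattice2_le (n₁ n₂ : ℕ) (x : Fin n₁ × Fin n₂) :
    ∑ y, adjWeight (lattice2 n₁ n₂) x y ≤ 4 := by
  have h := sum_adjWeight_boxProd_mul (SimpleGraph.pathGraph n₁) (SimpleGraph.pathGraph n₂) x
    fun _ => 1
  simp only [mul_one] at h
  have h1 := sum_adjWeight_pathGraph_le n₁ x.1
  have h2 := sum_adjWeight_pathGraph_le n₂ x.2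
  rw [lattice2, h]
  linarith

end Lattice

/-! ### Sums of inverse eigenvalues -/

section Sums

theorem le_pathEigenvalue {n k : ℕ} (hk : k < n) :
    4 * ((k : ℝ) ^ 2 / n ^ 2) ≤ pathEigenvalue n k := by
  have hn : (0 : ℝ) < n := by exact_mod_cast Nat.pos_of_ne_zero (by omega)
  have hk' : (k : ℝ) ≤ n := by exact_mod_cast hk.le
  have h1 : |Real.pi * k / n| ≤ Real.pi := by
    rw [abs_of_nonneg (by positivity), div_le_iff₀ hn]
    gcongr
  have h2 := Real.cos_le_one_sub_mul_cos_sq h1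
  have h3 : 2 / Real.pi ^ 2 * (Real.pi * k / n) ^ 2 = 2 * ((k : ℝ) ^ 2 / n ^ 2) := by
    have := Real.pi_pos.ne'
    field_simp
  rw [h3] at h2
  unfold pathEigenvalue
  linarith

theorem pathEigenvalue_le (n k : ℕ) :
    pathEigenvalue n k ≤ Real.pi ^ 2 * ((k : ℝ) ^ 2 / n ^ 2) := by
  have h2 := Real.one_sub_sq_div_two_le_cos (x := Real.pi * k / n)
  have h3 : (Real.pi * k / n) ^ 2 = Real.pi ^ 2 * ((k : ℝ) ^ 2 / n ^ 2) := by ring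
  rw [h3] at h2
  unfold pathEigenvalue
  linarith

theorem pathEigenvalue_zero (n : ℕ) : pathEigenvalue n 0 = 0 := by
  simp [pathEigenvalue]

theorem sum_range_inv_sq_le (n : ℕ) : ∑ k ∈ Finset.range n, ((k : ℝ) ^ 2)⁻¹ ≤ 2 := by
  have h : ∀ m : ℕ, ∑ k ∈ Finset.range (m + 2), ((k : ℝ) ^ 2)⁻¹ ≤ 2 - ((m : ℝ) + 1)⁻¹ := by
    intro m
    induction m with
    | zero => norm_num [Finset.sum_range_succ]
    | succ m ih =>
      rw [Finset.sum_range_succ]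
      have : (((m + 2 : ℕ) : ℝ) ^ 2)⁻¹ ≤ ((m : ℝ) + 1)⁻¹ - (((m + 1 : ℕ) : ℝ) + 1)⁻¹ := by
        push_cast
        rw [inv_sub_inv (by positivity) (by positivity), inv_eq_one_div,
          div_le_div_iff₀ (by positivity) (by positivity)]
        nlinarith [(Nat.cast_nonneg m : (0 : ℝ) ≤ m)]
      linarith
  calc ∑ k ∈ Finset.range n, ((k : ℝ) ^ 2)⁻¹ ≤ ∑ k ∈ Finset.range (n + 2), ((k : ℝ) ^ 2)⁻¹ :=
        Finset.sum_le_sum_of_subset_of_nonneg (Finset.range_mono (by omega))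
          fun k _ _ => by positivity
    _ ≤ 2 - ((n : ℝ) + 1)⁻¹ := h n
    _ ≤ 2 := sub_le_self _ (by positivity)

theorem sum_range_inv_le (n : ℕ) : ∑ k ∈ Finset.range n, (k : ℝ)⁻¹ ≤ 1 + Real.log n := by
  have h : ∑ k ∈ Finset.range (n + 1), (k : ℝ)⁻¹ = harmonic n := by
    rw [Finset.sum_range_succ']
    simp [harmonic]
  refine le_trans ?_ (h.trans_le (harmonic_le_one_add_log n))
  exact Finset.sum_le_sum_of_subset_of_nonneg (Finset.range_mono (by omega))
    fun k _ _ => by positivity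

theorem log_le_sum_range_inv {n : ℕ} (hn : 0 < n) :
    Real.log n ≤ ∑ k ∈ Finset.range n, (k : ℝ)⁻¹ := by
  obtain ⟨m, rfl⟩ : ∃ m, n = m + 1 := ⟨n - 1, by omega⟩
  have h : ∑ k ∈ Finset.range (m + 1), (k : ℝ)⁻¹ = harmonic m := by
    rw [Finset.sum_range_succ']
    simp [harmonic]
  rw [h]
  exact log_add_one_le_harmonic m

theorem sum_inv_pathEigenvalue_le (n : ℕ) :
    ∑ k : Fin n, (pathEigenvalue n k)⁻¹ ≤ (n : ℝ) ^ 2 := by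
  have h : ∀ k : Fin n, (pathEigenvalue n k)⁻¹ ≤ (n : ℝ) ^ 2 / 4 * (((k : ℕ) : ℝ) ^ 2)⁻¹ := by
    intro k
    rcases Nat.eq_zero_or_pos k with hk | hk
    · simp [hk, pathEigenvalue_zero]
    · have hn : (0 : ℝ) < n := by exact_mod_cast hk.trans k.2
      have hk' : (0 : ℝ) < (k : ℕ) := by exact_mod_cast hk
      calc (pathEigenvalue n k)⁻¹ ≤ (4 * (((k : ℕ) : ℝ) ^ 2 / n ^ 2))⁻¹ :=
            inv_anti₀ (by positivity) (le_pathEigenvalue k.2)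
        _ = _ := by field_simp
  calc ∑ k : Fin n, (pathEigenvalue n k)⁻¹
      ≤ ∑ k : Fin n, (n : ℝ) ^ 2 / 4 * (((k : ℕ) : ℝ) ^ 2)⁻¹ := Finset.sum_le_sum fun k _ => h k
    _ = (n : ℝ) ^ 2 / 4 * ∑ k ∈ Finset.range n, ((k : ℝ) ^ 2)⁻¹ := by
        rw [← Finset.mul_sum, Fin.sum_univ_eq_sum_range fun k => ((k : ℝ) ^ 2)⁻¹]
    _ ≤ (n : ℝ) ^ 2 / 4 * 2 := by gcongr; exact sum_range_inv_sq_le n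
    _ ≤ (n : ℝ) ^ 2 := by nlinarith [sq_nonneg (n : ℝ)]

theorem pathEigenvalue_nonneg (n k : ℕ) : 0 ≤ pathEigenvalue n k := by
  unfold pathEigenvalue
  linarith [Real.cos_le_one (Real.pi * k / n)]

/-- The smallest nonzero eigenvalue alone accounts for the order of magnitude. -/
theorem le_sum_inv_pathEigenvalue {n : ℕ} (hn : 2 ≤ n) :
    (Real.pi ^ 2)⁻¹ * (n : ℝ) ^ 2 ≤ ∑ k : Fin n, (pathEigenvalue n k)⁻¹ := by
  have h1 := Finset.single_le_sum (f := fun k : Fin n => (pathEigenvalue n k)⁻¹)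
    (fun k _ => inv_nonneg.2 (pathEigenvalue_nonneg n k)) (Finset.mem_univ ⟨1, by omega⟩)
  refine le_trans ?_ h1
  have hn' : (0 : ℝ) < n := by exact_mod_cast (by omega : 0 < n)
  have h2 := le_pathEigenvalue (n := n) (k := 1) (by omega)
  have h3 := pathEigenvalue_le n 1
  have h4 : 0 < pathEigenvalue n 1 := lt_of_lt_of_le (by positivity) h2
  calc (Real.pi ^ 2)⁻¹ * (n : ℝ) ^ 2 = (Real.pi ^ 2 * (((1 : ℕ) : ℝ) ^ 2 / n ^ 2))⁻¹ := by
        have := Real.pi_pos.ne'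
        field_simp
        simp
    _ ≤ (pathEigenvalue n 1)⁻¹ := inv_anti₀ h4 h3

theorem sum_inv_add_sq_le {m n : ℕ} (hm : 0 < m) (hn : 0 < n) :
    ∑ k ∈ Finset.range m, ∑ l ∈ Finset.range n, ((k : ℝ) ^ 2 + (l : ℝ) ^ 2)⁻¹
      ≤ 4 + 2 * Real.log (m * n) := by
  -- the number of `l ≤ k` is at most `2 k`, unless `k = 0`, where the junk value `0⁻¹ = 0` helps
  have hhalf : ∀ m n : ℕ, ∑ k ∈ Finset.range m, ∑ l ∈ Finset.range n,
      (if l ≤ k then ((k : ℝ) ^ 2)⁻¹ else 0) ≤ 2 * (1 + Real.log m) := by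
    intro m n
    refine le_trans ?_ (mul_le_mul_of_nonneg_left (sum_range_inv_le m) zero_le_two)
    rw [Finset.mul_sum]
    refine Finset.sum_le_sum fun k _ => ?_
    rcases Nat.eq_zero_or_pos k with rfl | hk
    · simp
    · have hk1 : (1 : ℝ) ≤ k := by exact_mod_cast hk
      rw [← Finset.sum_filter, Finset.sum_const, nsmul_eq_mul]
      have hc : ((Finset.range n).filter fun l => l ≤ k).card ≤ k + 1 := by
        refine (Finset.card_le_card (t := Finset.range (k + 1)) fun l hl => ?_).trans
          (Finset.card_range _).le
        have := (Finset.mem_filter.1 hl).2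
        exact Finset.mem_range.2 (by omega)
      have hc' : (((Finset.range n).filter fun l => l ≤ k).card : ℝ) ≤ k + 1 := by exact_mod_cast hc
      calc _ ≤ ((k : ℝ) + 1) * ((k : ℝ) ^ 2)⁻¹ := by gcongr
        _ ≤ (2 * k) * ((k : ℝ) ^ 2)⁻¹ := by gcongr; linarith
        _ = 2 * (k : ℝ)⁻¹ := by field_simp
  have hterm : ∀ k l : ℕ, ((k : ℝ) ^ 2 + (l : ℝ) ^ 2)⁻¹
      ≤ (if l ≤ k then ((k : ℝ) ^ 2)⁻¹ else 0) + if k ≤ l then ((l : ℝ) ^ 2)⁻¹ else 0 := by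
    have haux : ∀ k l : ℕ, l ≤ k → ((k : ℝ) ^ 2 + (l : ℝ) ^ 2)⁻¹ ≤ ((k : ℝ) ^ 2)⁻¹ := by
      intro k l hl
      rcases Nat.eq_zero_or_pos k with rfl | hk
      · have : l = 0 := by omega
        simp [this]
      · have hk1 : (0 : ℝ) < k := by exact_mod_cast hk
        exact inv_anti₀ (by positivity) (le_add_of_nonneg_right (sq_nonneg _))
    intro k l
    rcases le_total l k with h | h
    · rw [if_pos h]
      have h1 := haux k l h
      have h2 : (0 : ℝ) ≤ if k ≤ l then ((l : ℝ) ^ 2)⁻¹ else 0 := by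
        split_ifs <;> positivity
      linarith
    · rw [if_pos h]
      have h1 := haux l k h
      rw [add_comm] at h1
      have h2 : (0 : ℝ) ≤ if l ≤ k then ((k : ℝ) ^ 2)⁻¹ else 0 := by
        split_ifs <;> positivity
      linarith
  have hm' : (m : ℝ) ≠ 0 := by exact_mod_cast hm.ne'
  have hn' : (n : ℝ) ≠ 0 := by exact_mod_cast hn.ne'
  have h1 := hhalf m n
  have h2 := hhalf n m
  rw [Finset.sum_comm] at h2
  have h3 := Finset.sum_le_sum fun k (_ : k ∈ Finset.range m) =>
    Finset.sum_le_sum fun l (_ : l ∈ Finset.range n) => hterm k l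
  simp only [Finset.sum_add_distrib] at h3
  rw [Real.log_mul hm' hn']
  linarith

theorem log_le_sum_inv_add_sq {m n₁ n₂ : ℕ} (hm : 0 < m) (h₁ : m ≤ n₁) (h₂ : m ≤ n₂) :
    Real.log m / 2 ≤ ∑ k ∈ Finset.range n₁, ∑ l ∈ Finset.range n₂,
      ((k : ℝ) ^ 2 + (l : ℝ) ^ 2)⁻¹ := by
  have h0 : ∀ k l : ℕ, 0 ≤ ((k : ℝ) ^ 2 + (l : ℝ) ^ 2)⁻¹ := fun k l => by positivity
  calc Real.log m / 2 ≤ (∑ k ∈ Finset.range m, (k : ℝ)⁻¹) / 2 := by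
        gcongr; exact log_le_sum_range_inv hm
    _ = ∑ k ∈ Finset.range m, (k : ℝ)⁻¹ / 2 := Finset.sum_div _ _ _
    _ ≤ ∑ k ∈ Finset.range m, ∑ l ∈ Finset.range n₂, ((k : ℝ) ^ 2 + (l : ℝ) ^ 2)⁻¹ := by
        refine Finset.sum_le_sum fun k hk => ?_
        have hkm := Finset.mem_range.1 hk
        rcases Nat.eq_zero_or_pos k with rfl | hk0
        · simpa using Finset.sum_nonneg fun l (_ : l ∈ Finset.range n₂) => h0 0 l
        have hk1 : (0 : ℝ) < k := by exact_mod_cast hk0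
        -- keep the `k` terms with `l < k`, each of which is at least `1 / (2 k²)`
        calc (k : ℝ)⁻¹ / 2 = ∑ l ∈ Finset.range k, ((k : ℝ) ^ 2 + (k : ℝ) ^ 2)⁻¹ := by
              rw [Finset.sum_const, Finset.card_range, nsmul_eq_mul]
              field_simp
              norm_num
          _ ≤ ∑ l ∈ Finset.range k, ((k : ℝ) ^ 2 + (l : ℝ) ^ 2)⁻¹ := by
              refine Finset.sum_le_sum fun l hl => ?_
              have : (l : ℝ) ≤ k := by exact_mod_cast (Finset.mem_range.1 hl).le
              gcongr
          _ ≤ ∑ l ∈ Finset.range n₂, ((k : ℝ) ^ 2 + (l : ℝ) ^ 2)⁻¹ :=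
              Finset.sum_le_sum_of_subset_of_nonneg (Finset.range_mono (by omega))
                fun l _ _ => h0 k l
    _ ≤ _ := Finset.sum_le_sum_of_subset_of_nonneg (Finset.range_mono h₁)
        fun k _ _ => Finset.sum_nonneg fun l _ => h0 k l

theorem sum_fin_prod_eq (n₁ n₂ : ℕ) (F : ℕ → ℕ → ℝ) :
    ∑ k : Fin n₁ × Fin n₂, F k.1 k.2
      = ∑ k ∈ Finset.range n₁, ∑ l ∈ Finset.range n₂, F k l := by
  rw [Fintype.sum_prod_type, ← Fin.sum_univ_eq_sum_range fun k => ∑ l ∈ Finset.range n₂, F k l]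
  exact Finset.sum_congr rfl fun k _ => Fin.sum_univ_eq_sum_range (F k) n₂

variable {n₁ n₂ : ℕ} {ρ : ℝ}

theorem sum_inv_latticeEigenvalue_le (hn₁ : 0 < n₁) (hn₂ : 0 < n₂) (hρ : 0 < ρ)
    (h₁ : (n₁ : ℝ) ≤ ρ * n₂) (h₂ : (n₂ : ℝ) ≤ ρ * n₁) :
    ∑ k : Fin n₁ × Fin n₂, (pathEigenvalue n₁ k.1 + pathEigenvalue n₂ k.2)⁻¹
      ≤ ρ * (n₁ * n₂) / 4 * (4 + 2 * Real.log (n₁ * n₂)) := by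
  have hn₁' : (0 : ℝ) < n₁ := by exact_mod_cast hn₁
  have hn₂' : (0 : ℝ) < n₂ := by exact_mod_cast hn₂
  refine le_trans ?_ (mul_le_mul_of_nonneg_left (sum_inv_add_sq_le hn₁ hn₂) (by positivity))
  rw [← sum_fin_prod_eq n₁ n₂ fun k l => ((k : ℝ) ^ 2 + (l : ℝ) ^ 2)⁻¹, Finset.mul_sum]
  refine Finset.sum_le_sum fun k _ => ?_
  by_cases h0 : (k.1 : ℕ) = 0 ∧ (k.2 : ℕ) = 0
  · simp [h0.1, h0.2, pathEigenvalue_zero]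
  · have hpos : 0 < ((k.1 : ℕ) : ℝ) ^ 2 + ((k.2 : ℕ) : ℝ) ^ 2 := by
      have : 0 < (k.1 : ℕ) ^ 2 + (k.2 : ℕ) ^ 2 := by
        by_contra hc
        exact h0 ⟨by nlinarith, by nlinarith⟩
      exact_mod_cast this
    have e1 := le_pathEigenvalue k.1.2
    have e2 := le_pathEigenvalue k.2.2
    have e3 : ((k.1 : ℕ) : ℝ) ^ 2 / (ρ * (n₁ * n₂)) ≤ ((k.1 : ℕ) : ℝ) ^ 2 / n₁ ^ 2 := by
      refine div_le_div_of_nonneg_left (sq_nonneg _) (by positivity) ?_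
      nlinarith
    have e4 : ((k.2 : ℕ) : ℝ) ^ 2 / (ρ * (n₁ * n₂)) ≤ ((k.2 : ℕ) : ℝ) ^ 2 / n₂ ^ 2 := by
      refine div_le_div_of_nonneg_left (sq_nonneg _) (by positivity) ?_
      nlinarith
    calc (pathEigenvalue n₁ k.1 + pathEigenvalue n₂ k.2)⁻¹
        ≤ (4 / (ρ * (n₁ * n₂)) * (((k.1 : ℕ) : ℝ) ^ 2 + ((k.2 : ℕ) : ℝ) ^ 2))⁻¹ := by
          refine inv_anti₀ (by positivity) ?_
          have : 4 / (ρ * (n₁ * n₂)) * (((k.1 : ℕ) : ℝ) ^ 2 + ((k.2 : ℕ) : ℝ) ^ 2)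
            = 4 * (((k.1 : ℕ) : ℝ) ^ 2 / (ρ * (n₁ * n₂)))
              + 4 * (((k.2 : ℕ) : ℝ) ^ 2 / (ρ * (n₁ * n₂))) := by ring
          linarith
      _ = _ := by rw [mul_inv, inv_div]

theorem le_sum_inv_latticeEigenvalue (hn₁ : 0 < n₁) (hn₂ : 0 < n₂) (hρ : 1 ≤ ρ)
    (h₁ : (n₁ : ℝ) ≤ ρ * n₂) (h₂ : (n₂ : ℝ) ≤ ρ * n₁) (hn : ρ ^ 2 ≤ n₁ * n₂) :
    (Real.pi ^ 2 * ρ)⁻¹ * (n₁ * n₂) * (Real.log (n₁ * n₂) / 8)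
      ≤ ∑ k : Fin n₁ × Fin n₂, (pathEigenvalue n₁ k.1 + pathEigenvalue n₂ k.2)⁻¹ := by
  have hn₁' : (0 : ℝ) < n₁ := by exact_mod_cast hn₁
  have hn₂' : (0 : ℝ) < n₂ := by exact_mod_cast hn₂
  have hpi := Real.pi_pos
  have hm : 0 < min n₁ n₂ := lt_min hn₁ hn₂
  have hm' : (0 : ℝ) < (min n₁ n₂ : ℕ) := by exact_mod_cast hm
  -- the shorter side `m` satisfies `m⁴ ≥ (n₁ n₂ / ρ)² ≥ n₁ n₂`
  have hlog : Real.log (n₁ * n₂) / 8 ≤ Real.log (min n₁ n₂ : ℕ) / 2 := by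
    have h1 : (n₁ * n₂ : ℝ) ≤ ρ * ((min n₁ n₂ : ℕ) : ℝ) ^ 2 := by
      rcases le_total n₁ n₂ with h | h
      · rw [min_eq_left h]; nlinarith
      · rw [min_eq_right h]; nlinarith
    have h2 : (n₁ * n₂ : ℝ) ^ 2 ≤ (n₁ * n₂) * ((min n₁ n₂ : ℕ) : ℝ) ^ 4 := by
      calc (n₁ * n₂ : ℝ) ^ 2 ≤ (ρ * ((min n₁ n₂ : ℕ) : ℝ) ^ 2) ^ 2 := by gcongr
        _ = ρ ^ 2 * ((min n₁ n₂ : ℕ) : ℝ) ^ 4 := by ring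
        _ ≤ _ := by gcongr
    have h3 : (n₁ * n₂ : ℝ) ≤ ((min n₁ n₂ : ℕ) : ℝ) ^ 4 := by
      rw [sq] at h2
      exact le_of_mul_le_mul_left h2 (by positivity)
    have h4 := Real.log_le_log (by positivity) h3
    rw [Real.log_pow] at h4
    push_cast at h4 ⊢
    linarith
  have hsum := hlog.trans (log_le_sum_inv_add_sq hm (min_le_left n₁ n₂) (min_le_right n₁ n₂))
  refine (mul_le_mul_of_nonneg_left hsum (by positivity)).trans ?_
  rw [← sum_fin_prod_eq n₁ n₂ fun k l => ((k : ℝ) ^ 2 + (l : ℝ) ^ 2)⁻¹, Finset.mul_sum]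
  refine Finset.sum_le_sum fun k _ => ?_
  by_cases h0 : (k.1 : ℕ) = 0 ∧ (k.2 : ℕ) = 0
  · simp [h0.1, h0.2, pathEigenvalue_zero]
  · have hpos : 0 < pathEigenvalue n₁ k.1 + pathEigenvalue n₂ k.2 := by
      have e1 := le_pathEigenvalue k.1.2
      have e2 := le_pathEigenvalue k.2.2
      have : 0 < 4 * (((k.1 : ℕ) : ℝ) ^ 2 / n₁ ^ 2) + 4 * (((k.2 : ℕ) : ℝ) ^ 2 / n₂ ^ 2) := by
        rcases not_and_or.1 h0 with h | h
        · have : (0 : ℝ) < (k.1 : ℕ) := by exact_mod_cast Nat.pos_of_ne_zero h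
          positivity
        · have : (0 : ℝ) < (k.2 : ℕ) := by exact_mod_cast Nat.pos_of_ne_zero h
          positivity
      linarith
    have e1 := pathEigenvalue_le n₁ k.1
    have e2 := pathEigenvalue_le n₂ k.2
    have hquot : ∀ a b x : ℝ, 0 < a → 0 < b → b ≤ ρ * a → x ^ 2 / a ^ 2
        ≤ ρ * (x ^ 2 / (a * b)) := by
      intro a b x ha hb hab
      rw [← mul_div_assoc, div_le_div_iff₀ (by positivity) (by positivity)]
      have := mul_le_mul_of_nonneg_left hab (by positivity : 0 ≤ x ^ 2 * a)
      linarith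
    have e3 := hquot n₁ n₂ (k.1 : ℕ) hn₁' hn₂' h₂
    have e4 := hquot n₂ n₁ (k.2 : ℕ) hn₂' hn₁' h₁
    rw [mul_comm (n₂ : ℝ)] at e4
    have e5 := mul_le_mul_of_nonneg_left (add_le_add e3 e4) (sq_nonneg Real.pi)
    calc (Real.pi ^ 2 * ρ)⁻¹ * (n₁ * n₂) * (((k.1 : ℕ) : ℝ) ^ 2 + ((k.2 : ℕ) : ℝ) ^ 2)⁻¹
        = (Real.pi ^ 2 * (ρ * (((k.1 : ℕ) : ℝ) ^ 2 / (n₁ * n₂))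
          + ρ * (((k.2 : ℕ) : ℝ) ^ 2 / (n₁ * n₂))))⁻¹ := by
          rw [← mul_add, ← add_div, mul_inv, mul_inv, mul_inv, inv_div]
          ring
      _ ≤ (pathEigenvalue n₁ k.1 + pathEigenvalue n₂ k.2)⁻¹ := by
          refine inv_anti₀ hpos ?_
          linarith

end Sums

/-! ### Performance scaling -/

theorem lossP_div_le {V : Type*} [Fintype V] [DecidableEq V] {G : SimpleGraph V} {b : V → V → ℝ}
    (hb : IsEdgeWeight G b) {α k γ q τ : ℝ} (hα : 0 < α) (hk : 0 < k) (hγ : 0 < γ) (hq : 0 < q)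
    (hτ : 0 < τ) (ε : ℝ) :
    lossP b α k γ q τ ε / Fintype.card V ≤ ENNReal.ofReal (α / (2 * k)) := by
  obtain ⟨U, μ, hU⟩ :=
    exists_isEigenbasis (posSemidef_laplacian hb.symm hb.self hb.nonneg).isHermitian
  exact ENNReal.div_le_of_le_mul
    (lossP_le hb.symm hb.self hb.nonneg hU (hU.eigenvalue_nonneg hb) hα hk hγ hq hτ ε)

theorem ofReal_le_div_natCast {n : ℕ} (hn : 0 < n) {x : ℝ} {l : ℝ≥0∞}
    (h : ENNReal.ofReal (x * n) ≤ l) : ENNReal.ofReal x ≤ l / n := by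
  rw [ENNReal.le_div_iff_mul_le (Or.inl (by exact_mod_cast hn.ne'))
    (Or.inl (ENNReal.natCast_ne_top n))]
  rwa [ENNReal.ofReal_mul' (Nat.cast_nonneg n), ENNReal.ofReal_natCast] at h

theorem div_natCast_le_ofReal {n : ℕ} {x : ℝ} {l : ℝ≥0∞}
    (h : l ≤ ENNReal.ofReal (x * n)) : l / n ≤ ENNReal.ofReal x := by
  refine ENNReal.div_le_of_le_mul ?_
  rwa [ENNReal.ofReal_mul' (Nat.cast_nonneg n), ENNReal.ofReal_natCast] at h

end PowerNetwork

end

theorem mainTheorem6 (α k γ q τ bmin bmax ρ : ℝ) (p : ℕ)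
    (hα : 0 < α) (hk : 0 < k) (hγ : 0 < γ) (hq : 0 < q) (hτ : 0 < τ)
    (hbmin : 0 < bmin) (hb : bmin ≤ bmax) (hρ : 1 ≤ ρ) (hp : 1 ≤ p) :
    -- measurement noise, one-dimensional lattices
    (∃ c C : ℝ, 0 < c ∧ 0 < C ∧ ∃ N : ℕ, ∀ n : ℕ, N ≤ n →
      ∀ b : Fin n → Fin n → ℝ,
        PowerNetwork.IsBoundedEdgeWeight ((SimpleGraph.pathGraph n).fuzz p) bmin bmax b →
        ∀ ε : ℝ, 0 < ε →
          ENNReal.ofReal (c * (ε ^ 2 * n)) ≤ PowerNetwork.lossEta b α k γ q τ ε / n ∧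
          PowerNetwork.lossEta b α k γ q τ ε / n ≤ ENNReal.ofReal (C * (ε ^ 2 * n))) ∧
    -- measurement noise, two-dimensional lattices (of bounded aspect ratio)
    (∃ c C : ℝ, 0 < c ∧ 0 < C ∧ ∃ N : ℕ, ∀ n₁ n₂ n : ℕ, n = n₁ * n₂ → N ≤ n →
      (n₁ : ℝ) ≤ ρ * n₂ → (n₂ : ℝ) ≤ ρ * n₁ →
      ∀ b : Fin n₁ × Fin n₂ → Fin n₁ × Fin n₂ → ℝ,
        PowerNetwork.IsBoundedEdgeWeight ((PowerNetwork.lattice2 n₁ n₂).fuzz p) bmin bmax b →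
        ∀ ε : ℝ, 0 < ε →
          ENNReal.ofReal (c * (ε ^ 2 * Real.log n)) ≤
            PowerNetwork.lossEta b α k γ q τ ε / n ∧
          PowerNetwork.lossEta b α k γ q τ ε / n ≤
            ENNReal.ofReal (C * (ε ^ 2 * Real.log n))) ∧
    -- power injection noise, one-dimensional lattices
    (∀ n : ℕ, 1 ≤ n → ∀ b : Fin n → Fin n → ℝ,
        PowerNetwork.IsEdgeWeight ((SimpleGraph.pathGraph n).fuzz p) b →
        ∀ ε : ℝ, 0 < ε →
          PowerNetwork.lossP b α k γ q τ ε / n ≤ ENNReal.ofReal (α / (2 * k))) ∧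
    -- power injection noise, two-dimensional lattices
    (∀ n₁ n₂ n : ℕ, n = n₁ * n₂ → 1 ≤ n →
      ∀ b : Fin n₁ × Fin n₂ → Fin n₁ × Fin n₂ → ℝ,
        PowerNetwork.IsEdgeWeight ((PowerNetwork.lattice2 n₁ n₂).fuzz p) b →
        ∀ ε : ℝ, 0 < ε →
          PowerNetwork.lossP b α k γ q τ ε / n ≤ ENNReal.ofReal (α / (2 * k))) := by
  have hpi := Real.pi_pos
  have hρ0 : 0 < ρ := zero_lt_one.trans_le hρ
  refine ⟨?_, ?_, ?_, ?_⟩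
  · obtain ⟨c, C, hc, hC, h⟩ := PowerNetwork.exists_lossEta_bounds (Δ := 2) hα hk hγ hq hτ hbmin hb
      hp zero_le_two
    refine ⟨c * (Real.pi ^ 2)⁻¹, C, by positivity, hC, 2, fun n hn b hbG ε _ => ?_⟩
    obtain ⟨U, hU⟩ := PowerNetwork.exists_isEigenbasis_pathGraph n
    obtain ⟨h1, h2⟩ := h _ _ U _ hU (PowerNetwork.sum_adjWeight_pathGraph_le n) b hbG ε
    have e1 := PowerNetwork.le_sum_inv_pathEigenvalue hn
    have e2 := PowerNetwork.sum_inv_pathEigenvalue_le n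
    constructor
    · refine PowerNetwork.ofReal_le_div_natCast (by omega) (le_trans ?_ h1)
      refine ENNReal.ofReal_le_ofReal ?_
      calc c * (Real.pi ^ 2)⁻¹ * (ε ^ 2 * n) * n
          = c * (ε ^ 2 * ((Real.pi ^ 2)⁻¹ * (n : ℝ) ^ 2)) := by ring
        _ ≤ _ := by gcongr
    · refine PowerNetwork.div_natCast_le_ofReal (h2.trans ?_)
      refine ENNReal.ofReal_le_ofReal ?_
      calc _ ≤ C * (ε ^ 2 * (n : ℝ) ^ 2) := by gcongr
        _ = C * (ε ^ 2 * n) * n := by ring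
  · obtain ⟨c, C, hc, hC, h⟩ := PowerNetwork.exists_lossEta_bounds (Δ := 4) hα hk hγ hq hτ hbmin hb
      hp zero_le_four
    refine ⟨c * ((Real.pi ^ 2 * ρ)⁻¹ / 8), C * (ρ * (3 / 2)), by positivity, by positivity,
      max 3 ⌈ρ ^ 2⌉₊, ?_⟩
    rintro n₁ n₂ n rfl hn h₁ h₂ b hbG ε _
    have hn3 : 3 ≤ n₁ * n₂ := (le_max_left _ _).trans hn
    have hnρ : ρ ^ 2 ≤ n₁ * n₂ := by
      have := Nat.ceil_le.1 ((le_max_right _ _).trans hn)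
      exact_mod_cast this
    have hpos : 0 < n₁ * n₂ := by omega
    have hn₁ : 0 < n₁ := Nat.pos_of_mul_pos_right hpos
    have hn₂ : 0 < n₂ := Nat.pos_of_mul_pos_left hpos
    obtain ⟨U₁, hU₁⟩ := PowerNetwork.exists_isEigenbasis_pathGraph n₁
    obtain ⟨U₂, hU₂⟩ := PowerNetwork.exists_isEigenbasis_pathGraph n₂
    obtain ⟨h1, h2⟩ := h _ _ _ _ (hU₁.boxProd hU₂) (PowerNetwork.sum_adjWeight_lattice2_le n₁ n₂)
      b hbG ε
    have e1 := PowerNetwork.le_sum_inv_latticeEigenvalue hn₁ hn₂ hρ h₁ h₂ hnρ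
    have e2 := PowerNetwork.sum_inv_latticeEigenvalue_le hn₁ hn₂ hρ0 h₁ h₂
    -- `log n ≥ 1` absorbs the additive constant of the upper bound
    have hlog : 1 ≤ Real.log (n₁ * n₂) := by
      rw [Real.le_log_iff_exp_le (by exact_mod_cast hpos)]
      have h3 : (3 : ℝ) ≤ n₁ * n₂ := by exact_mod_cast hn3
      linarith [Real.exp_one_lt_d9]
    constructor
    · refine PowerNetwork.ofReal_le_div_natCast hpos (le_trans ?_ h1)
      refine ENNReal.ofReal_le_ofReal ?_
      push_cast
      calc c * ((Real.pi ^ 2 * ρ)⁻¹ / 8) * (ε ^ 2 * Real.log (n₁ * n₂)) * (n₁ * n₂)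
          = c * (ε ^ 2 * ((Real.pi ^ 2 * ρ)⁻¹ * (n₁ * n₂) * (Real.log (n₁ * n₂) / 8))) := by ring
        _ ≤ _ := by gcongr
    · refine PowerNetwork.div_natCast_le_ofReal (h2.trans ?_)
      refine ENNReal.ofReal_le_ofReal ?_
      push_cast
      calc _ ≤ C * (ε ^ 2 * (ρ * (n₁ * n₂) / 4 * (4 + 2 * Real.log (n₁ * n₂)))) := by gcongr
        _ ≤ C * (ε ^ 2 * (ρ * (n₁ * n₂) / 4 * (6 * Real.log (n₁ * n₂)))) := by
            gcongr
            linarith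
        _ = C * (ρ * (3 / 2)) * (ε ^ 2 * Real.log (n₁ * n₂)) * (n₁ * n₂) := by ring
  · intro n _ b hbG ε _
    have h := PowerNetwork.lossP_div_le hbG hα hk hγ hq hτ ε
    rwa [Fintype.card_fin] at h
  · rintro n₁ n₂ n rfl _ b hbG ε _
    have h := PowerNetwork.lossP_div_le hbG hα hk hγ hq hτ ε
    rwa [Fintype.card_prod, Fintype.card_fin, Fintype.card_fin] at h
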